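/- **Setting.** Let $(\Omega,\mathcal F)$ be a measurable space and let $\mathcal H$ be a set of real random variables on it which contains the indicator $I_A$ of every $A\in\mathcal F$ and satisfies $\varphi(X_1,\dots,X_n)\in\mathcal H$ whenever $X_1,\dots,X_n\in\mathcal H$ and $|\varphi(x)-\varphi(y)|\le C(1+|x|^m+|y|^m)|x-y|$ on $\mathbb R^n$ for some $C>0$, $m\in\mathbb N$. A sublinear expectation is a functional $\mathbb E:\mathcal H\to[-\infty,\infty]$ such that for $X,Y\in\mathcal H$: $\mathbb E[X]\ge\mathbb E[Y]$ if $X\ge Y$; $\mathbb E[c]=c$ for $c\in\mathbb R$; $\mathbb E[\lambda X]=\lambda\mathbb E[X]$ for $\lambda\ge0$ (with $0\cdot(\pm\infty)=0$); $\mathbb E[X+Y]\le\mathbb E[X]+\mathbb E[Y]$ unless the right side has the form $\infty-\infty$ or $-\infty+\infty$. Assume $\mathbb E$ is countably sub-additive: $\mathbb E[X]\le\sum_{n\ge1}\mathbb E[Y_n]$ whenever $0\le X\le\sum_{n\ge1}Y_n$, $Y_n\ge0$, $X,Y_n\in\mathcal H$. Put $\mathbb V(A)=\inf\{\mathbb E[\xi]:I_A\le\xi,\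 \xi\in\mathcal H\}$ for $A\in\mathcal F$ and $$C_{\mathbb V}(X)=\int_0^\infty\mathbb V(X>x)\,dx+\int_{-\infty}^0\bigl(\mathbb V(X>x)-1\bigr)\,dx .$$ $Y\in\mathcal H$ is *independent* of $\mathbf X=(X_1,\dots,X_m)$, $X_i\in\mathcal H$, if for every Borel $\psi$ on $\mathbb R^m\times\mathbb R$ with $\psi(\mathbf X,Y)\in\mathcal H$ and $\psi(\mathbf x,Y)\in\mathcal H$ for all $\mathbf x$, one has $\mathbb E[\psi(\mathbf X,Y)]=\mathbb E\bigl[\mathbb E[\psi(\mathbf x,Y)]|_{\mathbf x=\mathbf X}\bigr]$ whenever $\bar\psi(\mathbf x):=\mathbb E[|\psi(\mathbf x,Y)|]<\infty$ for all $\mathbf x$, the variables $\bar\psi(\mathbf X)$ and $\mathbb E[\psi(\mathbf x,Y)]|_{\mathbf x=\mathbf X}$ lie in $\mathcal H$, and $\mathbb E[|\bar\psi(\mathbf X)|]<\infty$. A sequence $X_0,X_1,\dots$ in $\mathcal H$ is *independent* if $X_{n+1}$ is independent of $(X_0,\dots,X_n)$ for every $n\ge0$. $X,Y\in\mathcal H$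 are *identically distributed* if $\mathbb E[\psi(X)]=\mathbb E[\psi(Y)]$ for every Borel $\psi$ such that $\psi(X),\psi(Y)\in\mathcal H$ and both expectations are finite. For real $\alpha$ let $A_n^{\alpha}=(\alpha+1)(\alpha+2)\cdots(\alpha+n)/n!$ for $n\ge1$ (only indices $n\ge1$ are used below). **Corollary 3.1.** Let $\{X_n,n\ge0\}\subset\mathcal H$ be independent, each identically distributed as $X\in\mathcal H$, with $\mathbb E[X_i]=-\mathbb E[-X_i]=0$ for $i\ge1$. Let $r>1$, $p>\frac12$, $0<\alpha\le1$. The following are equivalent: (i) $$\begin{cases}C_{\mathbb V}\bigl(|X|^{(r-1)/(p\alpha)}\bigr)<\infty,&\text{if }0<\alpha<1-1/r,\\ C_{\mathbb V}\bigl(|X|^{r/p}\ln(1+|X|)\bigr)<\infty,&\text{if }\alpha=1-1/r,\\ C_{\mathbb V}\bigl(|X|^{r/p}\bigr)<\infty,&\text{if }1-1/r<\alpha\le1;\end{cases}$$ (ii) $$\sum_{n=1}^\infty n^{r-2}\,\mathbb V\Bigl(\max_{0\le j\le n-1}\Bigl|\sum_{i=0}^{j}\bigl(A_{n-i}^{\alpha-1}\bigr)^pX_i\Bigr|>\epsilon\,(A_n^{\alpha})^p\Bigr)<\infty\quad\text{for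 all }\epsilon>0 .$$ -/

import Mathlib

open scoped ENNReal

/-- Membership of `φ` in `C_{l,Lip}(ℝⁿ)`: local Lipschitz continuity with polynomial growth.
All norms on `ℝⁿ` give the same class; the norm used here is the sup norm of `Fin n → ℝ`. -/
def IsLocLip {n : ℕ} (φ : (Fin n → ℝ) → ℝ) : Prop :=
  ∃ C : ℝ, 0 < C ∧ ∃ m : ℕ, ∀ x y : Fin n → ℝ,
    |φ x - φ y| ≤ C * (1 + ‖x‖ ^ m + ‖y‖ ^ m) * ‖x - y‖

/-- A sublinear expectation space `(Ω, H, E)` over the measurable space `Ω`. The functional `E`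
takes values in `[-∞, ∞]`; only its values on `H` are meaningful, and only these are constrained
or used. -/
structure SublinearExpectationSpace (Ω : Type*) [MeasurableSpace Ω] where
  /-- The space of random variables. -/
  H : Set (Ω → ℝ)
  /-- The sublinear expectation. -/
  E : (Ω → ℝ) → EReal
  measurable_of_mem : ∀ X ∈ H, Measurable X
  indicator_mem : ∀ A : Set Ω, MeasurableSet A → A.indicator (fun _ => (1 : ℝ)) ∈ H
  comp_mem : ∀ (n : ℕ) (X : Fin n → Ω → ℝ), (∀ i, X i ∈ H) →
    ∀ φ : (Fin n → ℝ) → ℝ, IsLocLip φ → (fun ω => φ (fun i => X i ω)) ∈ H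
  mono : ∀ X ∈ H, ∀ Y ∈ H, (∀ ω, Y ω ≤ X ω) → E Y ≤ E X
  const : ∀ c : ℝ, E (fun _ => c) = (c : EReal)
  pos_homog : ∀ X ∈ H, ∀ c : ℝ, 0 ≤ c → E (fun ω => c * X ω) = (c : EReal) * E X
  subadd : ∀ X ∈ H, ∀ Y ∈ H, ¬ (E X = ⊤ ∧ E Y = ⊥) → ¬ (E X = ⊥ ∧ E Y = ⊤) →
    E (fun ω => X ω + Y ω) ≤ E X + E Y

namespace SublinearExpectationSpace

variable {Ω : Type*} [MeasurableSpace Ω] (S : SublinearExpectationSpace Ω)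

/-- Countable sub-additivity: `E X ≤ ∑ E (Y n)` whenever `X ≤ ∑ Y n` with nonnegative
`X, Y n ∈ H`. All quantities are nonnegative, so both series are read in `[0, ∞]`. -/
def CountablySubadditive : Prop :=
  ∀ X ∈ S.H, ∀ Y : ℕ → Ω → ℝ, (∀ n, Y n ∈ S.H) → (∀ ω, 0 ≤ X ω) → (∀ n ω, 0 ≤ Y n ω) →
    (∀ ω, ENNReal.ofReal (X ω) ≤ ∑' n, ENNReal.ofReal (Y n ω)) →
    (S.E X).toENNReal ≤ ∑' n, (S.E (Y n)).toENNReal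

/-- The capacity `V(A) = inf {E ξ : 1_A ≤ ξ, ξ ∈ H}`. The infimum lies in `[0, 1]`, since
`E ξ ≥ E 0 = 0` for each such `ξ` and `ξ = 1` is admissible. -/
noncomputable def capacity (A : Set Ω) : ℝ≥0∞ :=
  (sInf {y : EReal | ∃ ξ ∈ S.H, (∀ ω, A.indicator (fun _ => (1 : ℝ)) ω ≤ ξ ω) ∧
    S.E ξ = y}).toENNReal

/-- The Choquet expectation `∫₀^∞ V(X > x) dx + ∫_{-∞}^0 (V(X > x) - 1) dx`. As `V ≤ 1`, the
second integral is minus the integral of the nonnegative function `1 - V(X > x)`. -/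
noncomputable def choquet (X : Ω → ℝ) : EReal :=
  ((∫⁻ x in Set.Ioi (0 : ℝ), S.capacity {ω | x < X ω} : ℝ≥0∞) : EReal) -
    ((∫⁻ x in Set.Iio (0 : ℝ), (1 - S.capacity {ω | x < X ω}) : ℝ≥0∞) : EReal)

/-- `Y` is independent of the random vector `X = (X₁, …, X_m)`: for Borel `ψ` with
`ψ(X, Y) ∈ H` and `ψ(x, Y) ∈ H` for each `x`, one has `E[ψ(X, Y)] = E[E[ψ(x, Y)]|_{x = X}]`
whenever `ψ̄(x) = E|ψ(x, Y)|` is finite for each `x` and `E[|ψ̄(X)|] < ∞`. The random variables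
`ψ̄(X)` and `E[ψ(x, Y)]|_{x = X}` have to belong to `H` for these expressions to make sense.
Finiteness of `ψ̄(x)` makes `E[ψ(x, Y)]` finite, so `toReal` loses nothing. -/
def IndepOf {m : ℕ} (Y : Ω → ℝ) (X : Fin m → Ω → ℝ) : Prop :=
  ∀ ψ : (Fin m → ℝ) × ℝ → ℝ, Measurable ψ →
    (fun ω => ψ (fun i => X i ω, Y ω)) ∈ S.H →
    (∀ x : Fin m → ℝ, (fun ω => ψ (x, Y ω)) ∈ S.H) →
    (∀ x : Fin m → ℝ, S.E (fun ω => |ψ (x, Y ω)|) < ⊤) →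
    (fun ω => (S.E (fun ω' => |ψ (fun i => X i ω, Y ω')|)).toReal) ∈ S.H →
    S.E (fun ω => |(S.E (fun ω' => |ψ (fun i => X i ω, Y ω')|)).toReal|) < ⊤ →
    (fun ω => (S.E (fun ω' => ψ (fun i => X i ω, Y ω'))).toReal) ∈ S.H →
    S.E (fun ω => ψ (fun i => X i ω, Y ω)) =
      S.E (fun ω => (S.E (fun ω' => ψ (fun i => X i ω, Y ω'))).toReal)

/-- `X₀, X₁, X₂, …` is a sequence of independent random variables: `X_{n+1}` is independent of
`(X₀, …, X_n)` for each `n`. -/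
def IndepSeq (X : ℕ → Ω → ℝ) : Prop :=
  ∀ n : ℕ, S.IndepOf (X (n + 1)) (fun i : Fin (n + 1) => X i)

/-- `X` and `Y` are identically distributed: `E[ψ(X)] = E[ψ(Y)]` for each Borel `ψ` with
`ψ(X), ψ(Y) ∈ H`, whenever these sublinear expectations are finite. -/
def IdentDistr (X Y : Ω → ℝ) : Prop :=
  ∀ ψ : ℝ → ℝ, Measurable ψ → (fun ω => ψ (X ω)) ∈ S.H → (fun ω => ψ (Y ω)) ∈ S.H →
    S.E (fun ω => ψ (X ω)) ≠ ⊤ → S.E (fun ω => ψ (X ω)) ≠ ⊥ →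
    S.E (fun ω => ψ (Y ω)) ≠ ⊤ → S.E (fun ω => ψ (Y ω)) ≠ ⊥ →
    S.E (fun ω => ψ (X ω)) = S.E (fun ω => ψ (Y ω))

end SublinearExpectationSpace

/-- Cesàro numbers `A_n^α = (α+1)(α+2)⋯(α+n)/n!` for `n ≥ 1`, with the convention `A_0^α = 0`. -/
noncomputable def cesaroNumber (α : ℝ) (n : ℕ) : ℝ :=
  if n = 0 then 0 else (∏ k ∈ Finset.range n, (α + ((k : ℝ) + 1))) / (n.factorial : ℝ)

/-! Both conditions are equivalent to the finiteness of one double series, `triangleSum`: the sum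
over k ≤ n of n^(r-2) V(|X| > c (n^α k^(1-α))^p). It appears because A_n^α has order n^α and
A_k^(α-1) has order k^(α-1), so the normalised weight (A_k^(α-1) / A_n^α)^p has order (n^α
k^(1-α))^(-p) (`exists_cesaro_quotient_bounds`).

Choquet side (`choquet_conditions_iff`). V is not additive, so Fubini over Ω is not available. But x
↦ V(Z > x) is antitone, and integrals of an antitone function against two measures on the half-line
compare as soon as the masses of initial segments do. The total weight n^(r-2) of the pairs with n^α
k^(1-α) ≤ t is, up to constants, t^((r-1)/α) ∑_{k ≤ t} k^(-e) with e = (1-α)(r-1)/α (`count_le`,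
`le_count`). The exponent e is above, equal to or below 1 as α is below, equal to or above 1 - 1/r,
whence the three moment functions. These do not involve c, so finiteness of the double series for
one c gives it for all c.

From the double series to (ii) (`tsum_capacity_lt_top`). The normalised terms are truncated at δ;
those exceeding δ cost at most a `triangleSum`. For the truncated sums a Chernoff bound applies:
independence factorises exponential moments (`E_prod_le`), the zero mean removes the linear term,
and moments of order q = min(r/p, 2) are finite by countable sub-additivity (`exists_moment_bound`).
Since p q = min(r, 2p) > 1, the q-th powers of the normalised weights sum to O(n^(-η)), and an
exponential parameter proportional to log n yields any polynomial decay. That pays for a plain union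
bound over the partial sums.

From (ii) to the double series (`exists_triangleSum_lt_top`). A large term forces a large partial
sum. Lower probabilities of independent events multiply exactly (`one_sub_prob_biUnion`), so the
probability that some term is large is at least min(s_n, 1)/2, where s_n is the sum of the
individual probabilities. A doubling property of the row sums then removes the minimum
(`tsum_lt_top_of_tsum_min_lt_top`). -/

namespace SublinearExpectationSpace

/-! ### Closure properties of `H` and the capacity of measurable sets -/

variable {Ω : Type*} [MeasurableSpace Ω] (S : SublinearExpectationSpace Ω)

theorem const_mem (c : ℝ) : (fun _ : Ω => c) ∈ S.H :=
  S.comp_mem 0 (fun _ _ => 0) (fun i => i.elim0) (fun _ => c)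
    ⟨1, one_pos, 0, fun x y => by simp; positivity⟩

variable {S}

theorem comp_mem_one {X : Ω → ℝ} (hX : X ∈ S.H) {φ : ℝ → ℝ} {C : ℝ} (hC : 0 < C) (m : ℕ)
    (h : ∀ x y, |φ x - φ y| ≤ C * (1 + |x| ^ m + |y| ^ m) * |x - y|) :
    (fun ω => φ (X ω)) ∈ S.H := by
  refine S.comp_mem 1 (fun _ => X) (fun _ => hX) (fun x => φ (x 0)) ⟨C, hC, m, fun x y => ?_⟩
  have e : ∀ z : Fin 1 → ℝ, ‖z‖ = |z 0| := fun z => by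
    rw [← Real.norm_eq_abs]
    exact le_antisymm ((pi_norm_le_iff_of_nonneg (norm_nonneg _)).2 fun i => by
      rw [Subsingleton.elim i 0]) (norm_le_pi_norm z 0)
  simpa [e] using h (x 0) (y 0)

theorem lipschitz_comp_mem {X : Ω → ℝ} (hX : X ∈ S.H) {φ : ℝ → ℝ} {C : ℝ} (hC : 0 < C)
    (h : ∀ x y, |φ x - φ y| ≤ C * |x - y|) : (fun ω => φ (X ω)) ∈ S.H :=
  comp_mem_one hX hC 0 fun x y => (h x y).trans <| by
    gcongr
    simp only [pow_zero]; linarith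

theorem add_mem {X Y : Ω → ℝ} (hX : X ∈ S.H) (hY : Y ∈ S.H) : (fun ω => X ω + Y ω) ∈ S.H := by
  have := S.comp_mem 2 ![X, Y] (fun i => by fin_cases i <;> simpa) (fun x => x 0 + x 1)
    ⟨2, two_pos, 0, fun x y => by
      have h0 := norm_le_pi_norm (x - y) 0
      have h1 := norm_le_pi_norm (x - y) 1
      simp only [Pi.sub_apply, Real.norm_eq_abs] at h0 h1
      have : |x 0 + x 1 - (y 0 + y 1)| ≤ |x 0 - y 0| + |x 1 - y 1| := by
        rw [show x 0 + x 1 - (y 0 + y 1) = (x 0 - y 0) + (x 1 - y 1) by ring]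
        exact abs_add_le _ _
      simp only [pow_zero]
      nlinarith [norm_nonneg (x - y)]⟩
  simpa using this

theorem mul_mem {X Y : Ω → ℝ} (hX : X ∈ S.H) (hY : Y ∈ S.H) : (fun ω => X ω * Y ω) ∈ S.H := by
  have := S.comp_mem 2 ![X, Y] (fun i => by fin_cases i <;> simpa) (fun x => x 0 * x 1)
    ⟨1, one_pos, 1, fun x y => by
      have h0 := norm_le_pi_norm (x - y) 0
      have h1 := norm_le_pi_norm (x - y) 1
      have hx := norm_le_pi_norm x 0
      have hy := norm_le_pi_norm y 1
      simp only [Pi.sub_apply, Real.norm_eq_abs] at h0 h1 hx hy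
      have : |x 0 * x 1 - y 0 * y 1| ≤ |x 0| * |x 1 - y 1| + |x 0 - y 0| * |y 1| := by
        rw [← abs_mul, ← abs_mul,
          show x 0 * x 1 - y 0 * y 1 = x 0 * (x 1 - y 1) + (x 0 - y 0) * y 1 by ring]
        exact abs_add_le _ _
      have a1 := mul_le_mul hx h1 (abs_nonneg _) (norm_nonneg _)
      have a2 := mul_le_mul h0 hy (abs_nonneg _) (norm_nonneg _)
      simp only [pow_one]
      nlinarith [norm_nonneg (x - y)]⟩
  simpa using this

theorem smul_mem {X : Ω → ℝ} (c : ℝ) (hX : X ∈ S.H) : (fun ω => c * X ω) ∈ S.H :=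
  mul_mem (S.const_mem c) hX

theorem neg_mem {X : Ω → ℝ} (hX : X ∈ S.H) : (fun ω => -X ω) ∈ S.H := by
  simpa using smul_mem (-1) hX

theorem abs_mem {X : Ω → ℝ} (hX : X ∈ S.H) : (fun ω => |X ω|) ∈ S.H :=
  lipschitz_comp_mem hX one_pos fun x y => by simpa using abs_abs_sub_abs_le_abs_sub x y

theorem prod_mem {ι : Type*} (s : Finset ι) {X : ι → Ω → ℝ} (hX : ∀ i, X i ∈ S.H) :
    (fun ω => ∏ i ∈ s, X i ω) ∈ S.H := by
  classical
  induction s using Finset.induction_on with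
  | empty => simpa using S.const_mem 1
  | insert a s ha ih => simpa [Finset.prod_insert ha] using mul_mem (hX a) ih

theorem E_le_of_le_const {X : Ω → ℝ} (hX : X ∈ S.H) {c : ℝ} (h : ∀ ω, X ω ≤ c) : S.E X ≤ c :=
  (S.const c) ▸ S.mono _ (S.const_mem c) _ hX h

theorem le_E_of_const_le {X : Ω → ℝ} (hX : X ∈ S.H) {c : ℝ} (h : ∀ ω, c ≤ X ω) :
    (c : EReal) ≤ S.E X :=
  (S.const c) ▸ S.mono _ hX _ (S.const_mem c) h

/-- The sublinear expectation of a bounded random variable is a real number. -/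
theorem coe_toReal_E {X : Ω → ℝ} (hX : X ∈ S.H) {c : ℝ} (h : ∀ ω, |X ω| ≤ c) :
    (((S.E X).toReal : ℝ) : EReal) = S.E X := by
  apply EReal.coe_toReal
  · exact ne_of_lt ((E_le_of_le_const hX fun ω => (abs_le.1 (h ω)).2).trans_lt (EReal.coe_lt_top _))
  · exact ne_of_gt ((EReal.bot_lt_coe _).trans_le
      (le_E_of_const_le hX fun ω => (abs_le.1 (h ω)).1))

theorem E_add_le {X Y : Ω → ℝ} (hX : X ∈ S.H) (hY : Y ∈ S.H) {a b : ℝ} (ha : S.E X ≤ a)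
    (hb : S.E Y ≤ b) : S.E (fun ω => X ω + Y ω) ≤ ((a + b : ℝ) : EReal) := by
  have hXt : S.E X ≠ ⊤ := ne_of_lt (ha.trans_lt (EReal.coe_lt_top _))
  have hYt : S.E Y ≠ ⊤ := ne_of_lt (hb.trans_lt (EReal.coe_lt_top _))
  rw [EReal.coe_add]
  exact (S.subadd X hX Y hY (fun h => hXt h.1) (fun h => hYt h.2)).trans (add_le_add ha hb)

theorem E_smul_le {X : Ω → ℝ} (hX : X ∈ S.H) {a c : ℝ} (hc : 0 ≤ c) (ha : S.E X ≤ a) :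
    S.E (fun ω => c * X ω) ≤ ((c * a : ℝ) : EReal) := by
  rw [S.pos_homog X hX c hc, EReal.coe_mul]
  exact mul_le_mul_of_nonneg_left ha (by exact_mod_cast hc)

/-- The real-valued capacity of a measurable set. -/
noncomputable def prob (S : SublinearExpectationSpace Ω) (A : Set Ω) : ℝ :=
  (S.E (A.indicator fun _ => (1 : ℝ))).toReal

theorem indicator_one_nonneg {ι : Type*} (A : Set ι) (ω : ι) : 0 ≤ A.indicator (fun _ => (1 : ℝ)) ω :=
  Set.indicator_nonneg (fun _ _ => zero_le_one) ω

theorem indicator_one_le_one {ι : Type*} (A : Set ι) (ω : ι) : A.indicator (fun _ => (1 : ℝ)) ω ≤ 1 :=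
  Set.indicator_le' (fun _ _ => le_rfl) (fun _ _ => zero_le_one) ω

theorem coe_prob {A : Set Ω} (hA : MeasurableSet A) :
    (S.prob A : EReal) = S.E (A.indicator fun _ => (1 : ℝ)) :=
  coe_toReal_E (S.indicator_mem A hA) (c := 1) fun ω => by
    rw [abs_of_nonneg (indicator_one_nonneg A ω)]; exact indicator_one_le_one A ω

theorem prob_nonneg {A : Set Ω} (hA : MeasurableSet A) : 0 ≤ S.prob A := by
  have := le_E_of_const_le (S.indicator_mem A hA) (indicator_one_nonneg A)
  rw [← coe_prob hA] at this
  exact_mod_cast this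

theorem prob_le_one {A : Set Ω} (hA : MeasurableSet A) : S.prob A ≤ 1 := by
  have := E_le_of_le_const (S.indicator_mem A hA) (indicator_one_le_one A)
  rw [← coe_prob hA] at this
  exact_mod_cast this

/-- The infimum is attained at the indicator of `A`, which itself belongs to `H`. -/
theorem capacity_eq {A : Set Ω} (hA : MeasurableSet A) :
    S.capacity A = ENNReal.ofReal (S.prob A) := by
  have : sInf {y : EReal | ∃ ξ ∈ S.H, (∀ ω, A.indicator (fun _ => (1 : ℝ)) ω ≤ ξ ω) ∧
      S.E ξ = y} = (S.prob A : EReal) := by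
    rw [coe_prob hA]
    refine le_antisymm (sInf_le ⟨_, S.indicator_mem A hA, fun _ => le_rfl, rfl⟩) (le_sInf ?_)
    rintro _ ⟨ξ, hξ, h, rfl⟩
    exact S.mono _ hξ _ (S.indicator_mem A hA) h
  rw [capacity, this]
  simp

theorem prob_mono {A B : Set Ω} (hA : MeasurableSet A) (hB : MeasurableSet B) (h : A ⊆ B) :
    S.prob A ≤ S.prob B := by
  have := S.mono _ (S.indicator_mem B hB) _ (S.indicator_mem A hA)
    (Set.indicator_le_indicator_of_subset h fun _ => zero_le_one)
  rw [← coe_prob hA, ← coe_prob hB] at this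
  exact_mod_cast this

theorem prob_univ : S.prob Set.univ = 1 := by
  simp [prob, Set.indicator_univ, S.const 1]

theorem prob_union_le {A B C : Set Ω} (hA : MeasurableSet A) (hB : MeasurableSet B)
    (hC : MeasurableSet C) (h : C ⊆ A ∪ B) : S.prob C ≤ S.prob A + S.prob B := by
  have h1 := E_add_le (S.indicator_mem A hA) (S.indicator_mem B hB) (coe_prob hA).ge
    (coe_prob hB).ge
  have h2 := S.mono _ (add_mem (S.indicator_mem A hA) (S.indicator_mem B hB)) _
    (S.indicator_mem C hC) fun ω => by
      by_cases hω : ω ∈ C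
      · rcases h hω with h' | h'
        · simpa [hω, h'] using indicator_one_nonneg B ω
        · simpa [hω, h'] using indicator_one_nonneg A ω
      · simpa [hω] using add_nonneg (indicator_one_nonneg A ω) (indicator_one_nonneg B ω)
  rw [← coe_prob hC] at h2
  exact_mod_cast h2.trans h1

theorem prob_biUnion_le {ι : Type*} (s : Finset ι) {A : ι → Set Ω} {C : Set Ω}
    (hA : ∀ i, MeasurableSet (A i)) (hC : MeasurableSet C) (h : C ⊆ ⋃ i ∈ s, A i) :
    S.prob C ≤ ∑ i ∈ s, S.prob (A i) := by
  classical
  induction s using Finset.induction_on generalizing C with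
  | empty =>
    have : C = ∅ := by simpa [Set.subset_empty_iff] using h
    subst this
    have := S.const 0
    simp [prob, this]
  | insert a s ha ih =>
    rw [Finset.sum_insert ha]
    have hm : MeasurableSet (⋃ i ∈ s, A i) := s.measurableSet_biUnion fun i _ => hA i
    exact (prob_union_le (hA a) hm hC (by simpa using h)).trans
      (add_le_add le_rfl (ih hm le_rfl))

/-- Markov's inequality. -/
theorem prob_le_of_le {A : Set Ω} (hA : MeasurableSet A) {ξ : Ω → ℝ} (hξ : ξ ∈ S.H)
    (h0 : ∀ ω, 0 ≤ ξ ω) (h1 : ∀ ω ∈ A, 1 ≤ ξ ω) {c : ℝ} (hc : S.E ξ ≤ c) : S.prob A ≤ c := by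
  have := (S.mono _ hξ _ (S.indicator_mem A hA) fun ω => by
    by_cases hω : ω ∈ A
    · simpa [hω] using h1 ω hω
    · simpa [hω] using h0 ω).trans hc
  rw [← coe_prob hA] at this
  exact_mod_cast this

theorem prob_preimage_eq {X Y : Ω → ℝ} (hX : X ∈ S.H) (hY : Y ∈ S.H) (h : S.IdentDistr X Y)
    {B : Set ℝ} (hB : MeasurableSet B) : S.prob (X ⁻¹' B) = S.prob (Y ⁻¹' B) := by
  have e : ∀ Z : Ω → ℝ, (fun ω => B.indicator (fun _ => (1 : ℝ)) (Z ω)) =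
      (Z ⁻¹' B).indicator fun _ => (1 : ℝ) := fun Z => rfl
  have hXB := S.measurable_of_mem X hX hB
  have hYB := S.measurable_of_mem Y hY hB
  have := h (B.indicator fun _ => (1 : ℝ)) (measurable_const.indicator hB)
  rw [e, e, ← coe_prob hXB, ← coe_prob hYB] at this
  exact_mod_cast this (S.indicator_mem _ hXB) (S.indicator_mem _ hYB) (EReal.coe_ne_top _)
    (EReal.coe_ne_bot _) (EReal.coe_ne_top _) (EReal.coe_ne_bot _)

/-! ### Products of independent factors -/

/-- For a bounded product of a nonnegative function of `X` and a function of `Y`, the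
independence of `Y` and `X` amounts to integrating out the second factor. -/
theorem IndepOf.E_mul {m : ℕ} {X : Fin m → Ω → ℝ} {Y : Ω → ℝ} (h : S.IndepOf Y X)
    {f : (Fin m → ℝ) → ℝ} {g : ℝ → ℝ} (hf : Measurable f) (hg : Measurable g)
    (hf0 : ∀ x, 0 ≤ f x) {a b : ℝ} (hfa : ∀ x, f x ≤ a) (hgb : ∀ y, |g y| ≤ b)
    (hfX : (fun ω => f fun i => X i ω) ∈ S.H) (hgY : (fun ω => g (Y ω)) ∈ S.H) :
    S.E (fun ω => f (fun i => X i ω) * g (Y ω)) =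
      S.E (fun ω => (S.E fun ω' => g (Y ω')).toReal * f (fun i => X i ω)) := by
  have hb : 0 ≤ b := (abs_nonneg _).trans (hgb 0)
  -- Because `f x` is nonnegative, positive homogeneity pulls it out of both inner expectations;
  -- boundedness takes care of the finiteness clauses of independence.
  have habs : ∀ x, (S.E fun ω => |f x * g (Y ω)|).toReal =
      (S.E fun ω => |g (Y ω)|).toReal * f x := fun x => by
    simp only [abs_mul, abs_of_nonneg (hf0 x)]
    rw [S.pos_homog _ (abs_mem hgY) _ (hf0 x), EReal.toReal_mul, EReal.toReal_coe, mul_comm]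
  have hmul : ∀ x, (S.E fun ω => f x * g (Y ω)).toReal =
      (S.E fun ω => g (Y ω)).toReal * f x := fun x => by
    rw [S.pos_homog _ hgY _ (hf0 x), EReal.toReal_mul, EReal.toReal_coe, mul_comm]
  have hfg : ∀ x y, |f x * g y| ≤ a * b := fun x y => by
    rw [abs_mul, abs_of_nonneg (hf0 x)]
    exact mul_le_mul (hfa x) (hgb y) (abs_nonneg _) ((hf0 x).trans (hfa x))
  have key := h (fun z => f z.1 * g z.2)
    ((hf.comp measurable_fst).mul (hg.comp measurable_snd)) (mul_mem hfX hgY)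
    (fun x => smul_mem (f x) hgY)
    (fun x => (E_le_of_le_const (abs_mem (smul_mem _ hgY)) fun ω => hfg _ _).trans_lt
      (EReal.coe_lt_top _))
  simp only [habs, hmul] at key
  refine key (smul_mem _ hfX) ((E_le_of_le_const (abs_mem (smul_mem _ hfX))
    (c := |(S.E fun ω => |g (Y ω)|).toReal| * a) fun ω => ?_).trans_lt (EReal.coe_lt_top _))
    (smul_mem _ hfX)
  rw [abs_mul, abs_of_nonneg (hf0 _)]
  exact mul_le_mul_of_nonneg_left (hfa _) (abs_nonneg _)

/-- The upper expectation of a product of independent nonnegative factors is at most the product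
of bounds of their upper expectations. -/
theorem E_prod_le {X : ℕ → Ω → ℝ} (hind : S.IndepSeq X) {g : ℕ → ℝ → ℝ}
    (hg : ∀ i, Measurable (g i)) (hg0 : ∀ i y, 0 ≤ g i y) {b : ℝ} (hgb : ∀ i y, g i y ≤ b)
    (hgX : ∀ i, (fun ω => g i (X i ω)) ∈ S.H) {c : ℕ → ℝ}
    (hc : ∀ i, S.E (fun ω => g i (X i ω)) ≤ c i) (n : ℕ) :
    S.E (fun ω => ∏ i ∈ Finset.range (n + 1), g i (X i ω)) ≤
      ((∏ i ∈ Finset.range (n + 1), c i : ℝ) : EReal) := by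
  have habs : ∀ i y, |g i y| ≤ b := fun i y => by rw [abs_of_nonneg (hg0 i y)]; exact hgb i y
  have hE0 : ∀ i, 0 ≤ (S.E fun ω => g i (X i ω)).toReal := fun i => by
    have := le_E_of_const_le (hgX i) fun ω => hg0 i _
    rw [← coe_toReal_E (hgX i) fun ω => habs i _] at this
    exact_mod_cast this
  have hEc : ∀ i, (S.E fun ω => g i (X i ω)).toReal ≤ c i := fun i => by
    have := hc i
    rw [← coe_toReal_E (hgX i) fun ω => habs i _] at this
    exact_mod_cast this
  induction n with
  | zero => simpa using hc 0
  | succ n ih =>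
    have key := (hind n).E_mul (f := fun x => ∏ i : Fin (n + 1), g i (x i)) (g := g (n + 1))
      (Finset.measurable_prod _ fun i _ => (hg i).comp (measurable_pi_apply i)) (hg _)
      (fun x => Finset.prod_nonneg fun i _ => hg0 _ _) (a := b ^ (n + 1))
      (fun x => (Finset.prod_le_prod (fun i _ => hg0 _ _) fun i _ => hgb _ _).trans
        (by simp)) (habs _)
      (prod_mem (X := fun (i : Fin (n + 1)) ω => g i (X i ω)) _ fun i => hgX i) (hgX _)
    have e : ∀ ω, ∏ i : Fin (n + 1), g i (X i ω) = ∏ i ∈ Finset.range (n + 1), g i (X i ω) :=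
      fun ω => Fin.prod_univ_eq_prod_range (fun i => g i (X i ω)) (n + 1)
    simp only [e] at key
    simp only [Finset.prod_range_succ _ (n + 1)]
    rw [key]
    refine (E_smul_le (prod_mem _ hgX) (hE0 _) ih).trans ?_
    rw [mul_comm]
    exact_mod_cast mul_le_mul_of_nonneg_left (hEc _)
      (Finset.prod_nonneg fun i _ => (hE0 i).trans (hEc i))

/-- The lower probability of an intersection of independent events is the product of the lower
probabilities. -/
theorem one_sub_prob_biUnion {X : ℕ → Ω → ℝ} (hX : ∀ i, X i ∈ S.H) (hind : S.IndepSeq X)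
    {B : ℕ → Set ℝ} (hB : ∀ i, MeasurableSet (B i)) (n : ℕ) :
    1 - S.prob (⋃ i ∈ Finset.range (n + 1), X i ⁻¹' B i) =
      ∏ i ∈ Finset.range (n + 1), (1 - S.prob (X i ⁻¹' B i)) := by
  have hXB : ∀ i, MeasurableSet (X i ⁻¹' B i) := fun i => S.measurable_of_mem _ (hX i) (hB i)
  set h : ℕ → ℝ → ℝ := fun i => (B i)ᶜ.indicator fun _ => (1 : ℝ) with hh
  have hm : ∀ i, Measurable (h i) := fun i => measurable_const.indicator (hB i).compl
  have h0 : ∀ i y, 0 ≤ h i y := fun i y => Set.indicator_nonneg (fun _ _ => zero_le_one) _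
  have h1 : ∀ i y, h i y ≤ 1 := fun i y =>
    Set.indicator_le' (fun _ _ => le_rfl) (fun _ _ => zero_le_one) y
  have hX1 : ∀ i, (fun ω => h i (X i ω)) ∈ S.H := fun i => S.indicator_mem _ (hXB i).compl
  -- Constants pass through `E` exactly: sub-additivity is applied once adding -1 and once adding 1.
  -- Hence E[-1_{Aᶜ}] = E[1_A - 1] = V(A) - 1.
  have shift : ∀ A : Set Ω, MeasurableSet A →
      S.E (fun ω => -Aᶜ.indicator (fun _ => (1 : ℝ)) ω) = ((S.prob A - 1 : ℝ) : EReal) := by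
    intro A hA
    have hAc := S.indicator_mem _ hA.compl
    have e : ∀ ω, A.indicator (fun _ => (1 : ℝ)) ω = 1 - Aᶜ.indicator (fun _ => (1 : ℝ)) ω :=
      fun ω => by by_cases hω : ω ∈ A <;> simp [hω]
    apply le_antisymm
    · have := E_add_le (S.indicator_mem A hA) (S.const_mem (-1)) (coe_prob hA).ge
        (S.const (-1)).le
      simpa [e, sub_eq_add_neg] using this
    · have hb : ∀ ω, |-Aᶜ.indicator (fun _ => (1 : ℝ)) ω| ≤ 1 := fun ω => by
        rw [abs_neg, abs_of_nonneg (indicator_one_nonneg _ ω)]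
        exact indicator_one_le_one _ ω
      have := E_add_le (neg_mem hAc) (S.const_mem 1) (coe_toReal_E (neg_mem hAc) hb).ge
        (S.const 1).le
      rw [show (fun ω => -Aᶜ.indicator (fun _ => (1 : ℝ)) ω + 1) =
        A.indicator fun _ => (1 : ℝ) from funext fun ω => by rw [e]; ring, ← coe_prob hA] at this
      rw [← coe_toReal_E (neg_mem hAc) hb]
      rw [EReal.coe_le_coe_iff] at this ⊢
      linarith
  have step : ∀ i, S.E (fun ω => -h i (X i ω)) = ((S.prob (X i ⁻¹' B i) - 1 : ℝ) : EReal) :=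
    fun i => shift _ (hXB i)
  have hprod : ∀ n ω, ∏ i ∈ Finset.range (n + 1), h i (X i ω) =
      (⋃ i ∈ Finset.range (n + 1), X i ⁻¹' B i)ᶜ.indicator (fun _ => (1 : ℝ)) ω := by
    intro n ω
    by_cases hω : ω ∈ ⋃ i ∈ Finset.range (n + 1), X i ⁻¹' B i
    · rw [Set.indicator_of_notMem (by simpa using hω)]
      obtain ⟨i, hi, hiB⟩ := Set.mem_iUnion₂.1 hω
      exact Finset.prod_eq_zero hi (by simpa [hh] using hiB)
    · rw [Set.indicator_of_mem hω]
      refine Finset.prod_eq_one fun i hi => ?_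
      have : X i ω ∉ B i := fun hc => hω (Set.mem_iUnion₂.2 ⟨i, hi, hc⟩)
      simp [hh, this]
  -- The minus sign goes to the last factor, so that the other factors stay nonnegative. Its
  -- expectation is V - 1 ≤ 0, and (V - 1)∏ = (1 - V)(-∏) brings back the negated product of the
  -- induction hypothesis with a nonnegative coefficient. So equality persists, not merely an
  -- inequality.
  have main : ∀ n, S.E (fun ω => -∏ i ∈ Finset.range (n + 1), h i (X i ω)) =
      ((-∏ i ∈ Finset.range (n + 1), (1 - S.prob (X i ⁻¹' B i)) : ℝ) : EReal) := by
    intro n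
    induction n with
    | zero => simp [step]
    | succ n ih =>
      have key := (hind n).E_mul (f := fun x => ∏ i : Fin (n + 1), h i (x i))
        (g := fun y => -h (n + 1) y)
        (Finset.measurable_prod _ fun i _ => (hm i).comp (measurable_pi_apply i)) (hm _).neg
        (fun x => Finset.prod_nonneg fun i _ => h0 _ _) (a := 1) (b := 1)
        (fun x => Finset.prod_le_one (fun i _ => h0 _ _) fun i _ => h1 _ _)
        (fun y => by rw [abs_neg, abs_of_nonneg (h0 _ _)]; exact h1 _ _)
        (prod_mem (X := fun (i : Fin (n + 1)) ω => h i (X i ω)) _ fun i => hX1 i)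
        (neg_mem (hX1 _))
      have e : ∀ ω, ∏ i : Fin (n + 1), h i (X i ω) = ∏ i ∈ Finset.range (n + 1), h i (X i ω) :=
        fun ω => Fin.prod_univ_eq_prod_range (fun i => h i (X i ω)) (n + 1)
      simp only [e, step, EReal.toReal_coe] at key
      have hle := prob_le_one (S := S) (hXB (n + 1))
      have key2 := S.pos_homog _ (neg_mem (prod_mem (Finset.range (n + 1)) hX1))
        (1 - S.prob (X (n + 1) ⁻¹' B (n + 1))) (by linarith)
      rw [ih, ← EReal.coe_mul] at key2
      simp only [Finset.prod_range_succ _ (n + 1)]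
      calc _ = _ := by simp only [← mul_neg]
        _ = _ := key
        _ = S.E fun ω => (1 - S.prob (X (n + 1) ⁻¹' B (n + 1))) *
              -∏ i ∈ Finset.range (n + 1), h i (X i ω) := by
            congr 1; ext ω; ring
        _ = _ := key2
        _ = _ := by congr 1; ring
  have := main n
  simp only [hprod] at this
  rw [shift _ (Finset.measurableSet_biUnion _ fun i _ => hXB i)] at this
  have : _ = _ := EReal.coe_injective this
  linarith

end SublinearExpectationSpace

/-! ### Power sums and the size of the Cesàro numbers -/

/-- For s ≥ 0 each term is at most n^s. For -1 < s < 0 the sum telescopes: Bernoulli's inequality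
for the concave power s + 1 gives (s + 1)(n+1)^s ≤ (n+1)^(s+1) - n^(s+1). -/
theorem rpow_sum_le {s : ℝ} (hs : -1 < s) :
    ∃ C : ℝ, 0 < C ∧ ∀ n : ℕ, ∑ i ∈ Finset.range n, ((i : ℝ) + 1) ^ s ≤ C * (n : ℝ) ^ (s + 1) := by
  have hs1 : 0 < s + 1 := by linarith
  rcases le_or_gt 0 s with h0 | h0
  · refine ⟨1, one_pos, fun n => ?_⟩
    rcases Nat.eq_zero_or_pos n with rfl | hn
    · simp [Real.zero_rpow hs1.ne']
    have : (0 : ℝ) < n := by exact_mod_cast hn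
    calc ∑ i ∈ Finset.range n, ((i : ℝ) + 1) ^ s ≤ ∑ i ∈ Finset.range n, (n : ℝ) ^ s := by
          refine Finset.sum_le_sum fun i hi => Real.rpow_le_rpow (by positivity) ?_ h0
          exact_mod_cast Finset.mem_range.1 hi
      _ = 1 * (n : ℝ) ^ (s + 1) := by
          rw [Finset.sum_const, Finset.card_range, nsmul_eq_mul, Real.rpow_add this, Real.rpow_one]
          ring
  · refine ⟨1 / (s + 1), by positivity, fun n => ?_⟩
    induction n with
    | zero => simp [Real.zero_rpow hs1.ne']
    | succ n ih =>
      rw [Finset.sum_range_succ]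
      have hn : (0 : ℝ) < n + 1 := by positivity
      have hb := rpow_one_add_le_one_add_mul_self (s := -1 / ((n : ℝ) + 1))
        (by rw [le_div_iff₀ hn]; linarith [(Nat.cast_nonneg n : (0 : ℝ) ≤ n)]) hs1.le (by linarith)
      have e : 1 + -1 / ((n : ℝ) + 1) = n / (n + 1) := by field_simp; ring
      rw [e, Real.div_rpow (by positivity) hn.le, div_le_iff₀ (by positivity)] at hb
      have e2 : ((n : ℝ) + 1) ^ (s + 1) = (n + 1) ^ s * (n + 1) := by
        rw [Real.rpow_add hn, Real.rpow_one]
      have e3 : (1 + (s + 1) * (-1 / ((n : ℝ) + 1))) * ((n : ℝ) + 1) ^ (s + 1) =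
          ((n : ℝ) + 1) ^ (s + 1) - (s + 1) * (n + 1) ^ s := by
        rw [e2]; field_simp; ring
      rw [e3] at hb
      push_cast
      have : ((n : ℝ) + 1) ^ s ≤ 1 / (s + 1) * (((n : ℝ) + 1) ^ (s + 1) - (n : ℝ) ^ (s + 1)) := by
        rw [one_div, inv_mul_eq_div, le_div_iff₀ hs1]; linarith
      calc _ ≤ _ := add_le_add ih this
        _ = _ := by ring

/-- Each factor is at most exp(α/(k+1)), and the harmonic sum is at most 1 + log; the 1 produces the
factor exp α. -/
theorem prod_one_add_div_le {α : ℝ} (hα : 0 ≤ α) (n : ℕ) :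
    ∏ k ∈ Finset.range (n + 1), (1 + α / ((k : ℝ) + 1)) ≤
      Real.exp α * ((n + 1 : ℕ) : ℝ) ^ α := by
  have h := harmonic_le_one_add_log (n + 1)
  have hn : (0 : ℝ) < ((n + 1 : ℕ) : ℝ) := by positivity
  calc ∏ k ∈ Finset.range (n + 1), (1 + α / ((k : ℝ) + 1))
      ≤ ∏ k ∈ Finset.range (n + 1), Real.exp (α / ((k : ℝ) + 1)) :=
        Finset.prod_le_prod (fun k _ => by positivity) fun k _ => by
          rw [add_comm]; exact Real.add_one_le_exp _
    _ = Real.exp (α * (harmonic (n + 1) : ℝ)) := by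
        rw [← Real.exp_sum, harmonic]
        push_cast
        rw [Finset.mul_sum]
        simp [div_eq_mul_inv]
    _ ≤ Real.exp (α * (1 + Real.log ((n + 1 : ℕ) : ℝ))) := by gcongr
    _ = _ := by
        rw [Real.rpow_def_of_pos hn, ← Real.exp_add]; ring_nf

/-- Induction with (1 + 1/(n+1))^α ≤ 1 + α/(n+1), which is Bernoulli's inequality for an exponent in
[0, 1]. -/
theorem rpow_le_prod_one_add_div {α : ℝ} (hα : 0 ≤ α) (hα1 : α ≤ 1) (n : ℕ) :
    ((n : ℝ) + 1) ^ α ≤ ∏ k ∈ Finset.range n, (1 + α / ((k : ℝ) + 1)) := by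
  induction n with
  | zero => simp
  | succ n ih =>
    rw [Finset.prod_range_succ]
    have hn : (0 : ℝ) < n + 1 := by positivity
    have hb := rpow_one_add_le_one_add_mul_self (s := 1 / ((n : ℝ) + 1))
      (by linarith [one_div_pos.2 hn]) hα hα1
    have e : (((n + 1 : ℕ) : ℝ) + 1) = (n + 1) * (1 + 1 / ((n : ℝ) + 1)) := by
      push_cast; field_simp
    rw [e, Real.mul_rpow hn.le (by positivity)]
    refine mul_le_mul ih (hb.trans_eq (by ring)) (by positivity) ?_
    exact Finset.prod_nonneg fun k _ => by positivity

theorem cesaroNumber_succ (α : ℝ) (n : ℕ) :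
    cesaroNumber α (n + 1) = ∏ k ∈ Finset.range (n + 1), (1 + α / ((k : ℝ) + 1)) := by
  rw [cesaroNumber, if_neg (Nat.succ_ne_zero n), ← Finset.prod_range_add_one_eq_factorial]
  push_cast
  rw [← Finset.prod_div_distrib]
  refine Finset.prod_congr rfl fun k _ => ?_
  field_simp
  ring

/-- The products for α - 1 and α telescope against each other. The bounds for α, which need a
nonnegative parameter, thereby transfer to α - 1 at the cost of a factor of order 1/n. -/
theorem cesaroNumber_sub_one_succ {α : ℝ} (hα : 0 < α) (n : ℕ) :
    cesaroNumber (α - 1) (n + 1) = cesaroNumber α (n + 1) * (α / (α + (n + 1))) := by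
  rw [cesaroNumber_succ, cesaroNumber_succ]
  induction n with
  | zero => simp; field_simp; ring
  | succ n ih =>
    rw [Finset.prod_range_succ, ih, Finset.prod_range_succ _ (n + 1)]
    push_cast
    field_simp
    ring

theorem cesaroNumber_bounds {α : ℝ} (hα : 0 < α) (hα1 : α ≤ 1) (n : ℕ) :
    ((n : ℝ) + 1) ^ α ≤ cesaroNumber α (n + 1) ∧
      cesaroNumber α (n + 1) ≤ Real.exp α * ((n : ℝ) + 1) ^ α := by
  rw [cesaroNumber_succ]
  constructor
  · refine le_trans ?_ (rpow_le_prod_one_add_div hα.le hα1 (n + 1))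
    exact Real.rpow_le_rpow (by positivity) (by push_cast; linarith) hα.le
  · simpa using prod_one_add_div_le hα.le n

theorem cesaroNumber_sub_one_bounds {α : ℝ} (hα : 0 < α) (hα1 : α ≤ 1) (n : ℕ) :
    α / 2 * ((n : ℝ) + 1) ^ (α - 1) ≤ cesaroNumber (α - 1) (n + 1) ∧
      cesaroNumber (α - 1) (n + 1) ≤ Real.exp α * ((n : ℝ) + 1) ^ (α - 1) := by
  have hn : (0 : ℝ) < n + 1 := by positivity
  obtain ⟨h1, h2⟩ := cesaroNumber_bounds hα hα1 n
  rw [cesaroNumber_sub_one_succ hα, Real.rpow_sub_one hn.ne']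
  have hpos : (0 : ℝ) < (n + 1) ^ α := by positivity
  constructor
  · calc α / 2 * (((n : ℝ) + 1) ^ α / (n + 1)) = ((n : ℝ) + 1) ^ α * (α / (2 * (n + 1))) := by
          field_simp
      _ ≤ _ := by
          refine mul_le_mul h1 ?_ (by positivity) (hpos.le.trans h1)
          gcongr
          linarith [(Nat.cast_nonneg n : (0 : ℝ) ≤ n)]
  · calc _ ≤ (Real.exp α * ((n : ℝ) + 1) ^ α) * (1 / (n + 1)) := by
          refine mul_le_mul h2 ?_ (by positivity) (by positivity)
          rw [div_le_div_iff₀ (by positivity) hn]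
          nlinarith [(Nat.cast_nonneg n : (0 : ℝ) ≤ n)]
      _ = _ := by ring

/-- Comparability of the weight quotients `(A_k^{α-1} / A_n^α)^p` with `n^{-pα} k^{-p(1-α)}`. -/
theorem exists_cesaro_quotient_bounds {p α : ℝ} (hp : 0 < p) (hα : 0 < α) (hα1 : α ≤ 1) :
    ∃ c C : ℝ, 0 < c ∧ 0 < C ∧ ∀ n k : ℕ,
      0 < cesaroNumber α (n + 1) ^ p ∧
      cesaroNumber α (n + 1) ^ p ≤
        c * (((n : ℝ) + 1) ^ α * ((k : ℝ) + 1) ^ (1 - α)) ^ p *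
          cesaroNumber (α - 1) (k + 1) ^ p ∧
      0 < cesaroNumber (α - 1) (k + 1) ^ p ∧
      C * (((n : ℝ) + 1) ^ α * ((k : ℝ) + 1) ^ (1 - α)) ^ p *
          cesaroNumber (α - 1) (k + 1) ^ p ≤ cesaroNumber α (n + 1) ^ p := by
  have hexp := Real.exp_pos α
  -- The factors exp α and α/2 come from the upper bound for A_n^α and the lower bound for
  -- A_k^(α-1); the second constant uses the lower bound 1 for A_n^α and the upper factor exp α for
  -- A_k^(α-1).
  refine ⟨(Real.exp α * (2 / α)) ^ p, (Real.exp α)⁻¹ ^ p, by positivity, by positivity,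
    fun n k => ?_⟩
  obtain ⟨h1, h2⟩ := cesaroNumber_bounds hα hα1 n
  obtain ⟨h3, h4⟩ := cesaroNumber_sub_one_bounds hα hα1 k
  have hn : (0 : ℝ) < n + 1 := by positivity
  have hk : (0 : ℝ) < k + 1 := by positivity
  have p1 : 0 < cesaroNumber α (n + 1) := lt_of_lt_of_le (by positivity) h1
  have p2 : 0 < cesaroNumber (α - 1) (k + 1) := lt_of_lt_of_le (by positivity) h3
  have ek : ((k : ℝ) + 1) ^ (1 - α) * ((k : ℝ) + 1) ^ (α - 1) = 1 := by
    rw [← Real.rpow_add hk]; simp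
  have hk' : (0 : ℝ) < (k + 1) ^ (1 - α) := by positivity
  refine ⟨by positivity, ?_, by positivity, ?_⟩
  · rw [← Real.mul_rpow (by positivity) (by positivity),
      ← Real.mul_rpow (by positivity) p2.le]
    refine Real.rpow_le_rpow p1.le (h2.trans ?_) hp.le
    calc Real.exp α * ((n : ℝ) + 1) ^ α = Real.exp α * (2 / α) *
          (((n : ℝ) + 1) ^ α * ((k : ℝ) + 1) ^ (1 - α)) *
          (α / 2 * ((k : ℝ) + 1) ^ (α - 1)) := by
          rw [show Real.exp α * (2 / α) * (((n : ℝ) + 1) ^ α * ((k : ℝ) + 1) ^ (1 - α)) *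
            (α / 2 * ((k : ℝ) + 1) ^ (α - 1)) = Real.exp α * ((n : ℝ) + 1) ^ α *
            ((2 / α) * (α / 2)) * (((k : ℝ) + 1) ^ (1 - α) * ((k : ℝ) + 1) ^ (α - 1)) by ring, ek]
          field_simp
      _ ≤ _ := by gcongr
  · rw [← Real.mul_rpow (by positivity) (by positivity),
      ← Real.mul_rpow (by positivity) p2.le]
    refine Real.rpow_le_rpow (by positivity) (le_trans ?_ h1) hp.le
    calc _ ≤ (Real.exp α)⁻¹ * (((n : ℝ) + 1) ^ α * ((k : ℝ) + 1) ^ (1 - α)) *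
          (Real.exp α * ((k : ℝ) + 1) ^ (α - 1)) := by gcongr
      _ = ((Real.exp α)⁻¹ * Real.exp α) * ((n : ℝ) + 1) ^ α *
          (((k : ℝ) + 1) ^ (1 - α) * ((k : ℝ) + 1) ^ (α - 1)) := by ring
      _ = _ := by rw [ek, inv_mul_cancel₀ hexp.ne']; ring

/-! ### Integrals of an antitone function against two measures -/

open MeasureTheory in
/-- If the superlevel sets of `f` are controlled by those of `g`, so is the integral. -/
theorem lintegral_le_of_superlevel_le {A B : Type*} [MeasurableSpace A] [MeasurableSpace B]
    {μ : Measure A} {ν : Measure B} {f : A → ℝ} {g : B → ℝ} (hf : Measurable f)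
    (hg : Measurable g) (hf0 : ∀ a, 0 ≤ f a) (hg0 : ∀ b, 0 ≤ g b) (hf1 : ∀ a, f a ≤ 1)
    {C D : ℝ≥0∞} (h : ∀ u, 0 < u → μ {a | u < f a} ≤ C * ν {b | u < g b} + D) (hC : C ≠ ⊤) :
    ∫⁻ a, ENNReal.ofReal (f a) ∂μ ≤ C * ∫⁻ b, ENNReal.ofReal (g b) ∂ν + D := by
  rw [lintegral_eq_lintegral_meas_lt μ (.of_forall hf0) hf.aemeasurable,
    lintegral_eq_lintegral_meas_lt ν (.of_forall hg0) hg.aemeasurable]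
  -- Since `f` ≤ 1, only levels u ≤ 1 count, so the additive error integrates to exactly `D`.
  have hm : Measurable ((Set.Iic (1 : ℝ)).indicator fun _ => D) :=
    measurable_const.indicator measurableSet_Iic
  calc ∫⁻ u in Set.Ioi 0, μ {a | u < f a}
      ≤ ∫⁻ u in Set.Ioi 0, (C * ν {b | u < g b} + (Set.Iic (1 : ℝ)).indicator (fun _ => D) u) := by
        refine setLIntegral_mono' measurableSet_Ioi fun u hu => ?_
        by_cases hu1 : u ≤ 1
        · simpa [hu1] using h u hu
        · have : {a | u < f a} = ∅ := by
            ext a; simpa using (hf1 a).trans (not_le.1 hu1).le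
          simp [this]
    _ = C * (∫⁻ u in Set.Ioi 0, ν {b | u < g b}) +
          ∫⁻ u in Set.Ioi 0, (Set.Iic (1 : ℝ)).indicator (fun _ => D) u := by
        rw [lintegral_add_right _ hm, lintegral_const_mul' _ _ hC]
    _ = _ := by
        rw [lintegral_indicator measurableSet_Iic, setLIntegral_const,
          Measure.restrict_apply measurableSet_Iic, Set.inter_comm, Set.Ioi_inter_Iic]
        simp

open MeasureTheory Classical in
-- Replaces Fubini for the non-additive V. In a finite set of indices with u < v(y i), let j have
-- the largest y j. The whole set lies in {y i ≤ y j}, while antitonicity puts (0, y j] inside the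
-- superlevel set of v, so the counting hypothesis at j compares the two.
theorem tsum_mul_le_lintegral_of_count_le {ι : Type*} [Countable ι] {v : ℝ → ℝ}
    (hv : Antitone v) (hv0 : ∀ x, 0 ≤ v x) (hv1 : ∀ x, v x ≤ 1) (w : ι → ℝ≥0∞) (y : ι → ℝ)
    {C D : ℝ≥0∞} (hC : C ≠ ⊤)
    (h : ∀ j, ∑' i, (if y i ≤ y j then w i else 0) ≤ C * ENNReal.ofReal (y j) + D) :
    ∑' i, w i * ENNReal.ofReal (v (y i)) ≤
      C * (∫⁻ x in Set.Ioi (0 : ℝ), ENNReal.ofReal (v x)) + D := by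
  let _ : MeasurableSpace ι := ⊤
  have key := lintegral_le_of_superlevel_le (μ := Measure.sum fun i => w i • Measure.dirac i)
    (ν := volume.restrict (Set.Ioi (0 : ℝ))) (f := fun i => v (y i)) (g := v) (C := C) (D := D)
    measurable_from_top hv.measurable (fun _ => hv0 _) hv0 (fun _ => hv1 _) (fun u hu => ?_) hC
  · simpa [lintegral_sum_measure] using key
  rw [Measure.sum_apply _ MeasurableSpace.measurableSet_top, ENNReal.tsum_eq_iSup_sum]
  refine iSup_le fun F => ?_
  have e : ∀ i, (w i • Measure.dirac i) {i | u < v (y i)} = if u < v (y i) then w i else 0 := by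
    intro i
    by_cases hi : u < v (y i) <;> simp [hi]
  simp only [e]
  rcases (F.filter fun i => u < v (y i)).eq_empty_or_nonempty with hF | hF
  · rw [← Finset.sum_filter, hF]; simp
  obtain ⟨j, hj, hmax⟩ := Finset.exists_max_image _ y hF
  have hj := (Finset.mem_filter.1 hj).2
  calc ∑ i ∈ F, (if u < v (y i) then w i else 0) ≤ ∑ i ∈ F, if y i ≤ y j then w i else 0 := by
        refine Finset.sum_le_sum fun i hi => ?_
        by_cases hui : u < v (y i)
        · simp [hui, hmax i (by simp [hi, hui])]
        · simp [hui]
    _ ≤ _ := ENNReal.sum_le_tsum F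
    _ ≤ _ := h j
    _ ≤ _ := by
        gcongr
        rw [Measure.restrict_apply (measurableSet_lt measurable_const hv.measurable)]
        calc ENNReal.ofReal (y j) = volume (Set.Ioc 0 (y j)) := by simp
          _ ≤ volume ({x | u < v x} ∩ Set.Ioi 0) :=
            measure_mono fun x hx => ⟨hj.trans_le (hv hx.2), hx.1⟩

open MeasureTheory Classical in
-- Converse comparison: if x > 0 and u < v(x), every index with y i ≤ x also has u < v(y i). The
-- hypothesis at x then places x in (0, R], where R is the bound built from the weight of the
-- superlevel set.
theorem lintegral_le_tsum_mul_of_le_count {ι : Type*} [Countable ι] {v : ℝ → ℝ}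
    (hv : Antitone v) (hv0 : ∀ x, 0 ≤ v x) (hv1 : ∀ x, v x ≤ 1) (w : ι → ℝ≥0∞) (y : ι → ℝ)
    {C D : ℝ≥0∞} (hC : C ≠ ⊤)
    (h : ∀ x, 0 < x → ENNReal.ofReal x ≤ C * ∑' i, (if y i ≤ x then w i else 0) + D) :
    (∫⁻ x in Set.Ioi (0 : ℝ), ENNReal.ofReal (v x)) ≤
      C * ∑' i, w i * ENNReal.ofReal (v (y i)) + D := by
  let _ : MeasurableSpace ι := ⊤
  have key := lintegral_le_of_superlevel_le (ν := Measure.sum fun i => w i • Measure.dirac i)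
    (μ := volume.restrict (Set.Ioi (0 : ℝ))) (g := fun i => v (y i)) (f := v) (C := C) (D := D)
    hv.measurable measurable_from_top hv0 (fun _ => hv0 _) hv1 (fun u hu => ?_) hC
  · simpa [lintegral_sum_measure] using key
  rw [Measure.sum_apply _ MeasurableSpace.measurableSet_top]
  have e : ∀ i, (w i • Measure.dirac i) {i | u < v (y i)} = if u < v (y i) then w i else 0 := by
    intro i
    by_cases hi : u < v (y i) <;> simp [hi]
  simp only [e]
  set R := C * (∑' i, if u < v (y i) then w i else 0) + D with hR
  by_cases hRt : R = ⊤
  · simp [hRt]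
  rw [Measure.restrict_apply (measurableSet_lt measurable_const hv.measurable)]
  calc _ ≤ volume (Set.Ioc 0 R.toReal) := by
        refine measure_mono fun x hx => ⟨hx.2, ?_⟩
        rw [← ENNReal.ofReal_le_iff_le_toReal hRt]
        refine (h x hx.2).trans ?_
        rw [hR]
        gcongr with i
        by_cases hi : y i ≤ x
        · simp [hi, (show u < v x from hx.1).trans_le (hv hi)]
        · simp [hi]
    _ = R := by simp [ENNReal.ofReal_toReal hRt]

/-! ### Counting the pairs below a threshold -/

/-- The weight `(n+1)^(r-2)`, supported on the pairs `(n, k)` with `k ≤ n`. -/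
noncomputable def triangleWeight (r : ℝ) (i : ℕ × ℕ) : ℝ≥0∞ :=
  if i.2 ≤ i.1 then ENNReal.ofReal (((i.1 : ℝ) + 1) ^ (r - 2)) else 0

/-- The threshold `(n+1)^α (k+1)^(1-α)` at the pair `(n, k)`. -/
noncomputable def triangleThreshold (α : ℝ) (i : ℕ × ℕ) : ℝ :=
  ((i.1 : ℝ) + 1) ^ α * ((i.2 : ℝ) + 1) ^ (1 - α)

/-- The partial sum `∑_{k ≤ N} k^(-e)`. -/
noncomputable def negPowerSum (e : ℝ) (N : ℕ) : ℝ :=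
  ∑ k ∈ Finset.range N, ((k : ℝ) + 1) ^ (-e)

theorem one_le_triangleThreshold {α : ℝ} (hα : 0 ≤ α) (hα1 : α ≤ 1) (i : ℕ × ℕ) :
    1 ≤ triangleThreshold α i :=
  one_le_mul_of_one_le_of_one_le
    (Real.one_le_rpow (by linarith [(Nat.cast_nonneg i.1 : (0 : ℝ) ≤ i.1)]) hα)
    (Real.one_le_rpow (by linarith [(Nat.cast_nonneg i.2 : (0 : ℝ) ≤ i.2)]) (by linarith))

section

variable {r α : ℝ}

/-- The base is the largest admissible n + 1 for given k and t. The sum of n^(r-2) up to it has the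
order of this (r-1)-th power, in which t and k separate. -/
theorem threshold_root_rpow {t : ℝ} (ht : 0 ≤ t) (k : ℕ) :
    ((t * ((k : ℝ) + 1) ^ (-(1 - α))) ^ (1 / α)) ^ (r - 1) =
      t ^ ((r - 1) / α) * ((k : ℝ) + 1) ^ (-((1 - α) * ((r - 1) / α))) := by
  have hk : (0 : ℝ) < k + 1 := by positivity
  rw [← Real.rpow_mul (by positivity), Real.mul_rpow ht (by positivity), ← Real.rpow_mul hk.le]
  congr 2 <;> ring

theorem triangleThreshold_le_iff (hα0 : 0 < α) {t : ℝ} (ht : 0 ≤ t) (n k : ℕ) :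
    triangleThreshold α (n, k) ≤ t ↔
      (n : ℝ) + 1 ≤ (t * ((k : ℝ) + 1) ^ (-(1 - α))) ^ (1 / α) := by
  have hk : (0 : ℝ) < k + 1 := by positivity
  have hk' : (0 : ℝ) < (k + 1) ^ (1 - α) := by positivity
  rw [triangleThreshold, Real.rpow_neg hk.le, ← div_eq_mul_inv, ← le_div_iff₀ hk', one_div,
    Real.le_rpow_inv_iff_of_pos (by positivity) (by positivity) hα0]

/-- For fixed k, summing (n+1)^(r-2) over the admissible n gives the power separated in
`threshold_root_rpow`. The constraint k ≤ n serves only to cut off k: it gives k + 1 = (k+1)^α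
(k+1)^(1-α) ≤ (n+1)^α (k+1)^(1-α) ≤ t. -/
theorem count_le (hr : 1 < r) (hα0 : 0 < α) :
    ∃ C : ℝ, 0 < C ∧ ∀ t : ℝ, 1 ≤ t →
      ∑' i, (if triangleThreshold α i ≤ t then triangleWeight r i else 0) ≤
        ENNReal.ofReal (C * (t ^ ((r - 1) / α) *
          negPowerSum ((1 - α) * ((r - 1) / α)) ⌊t⌋₊)) := by
  obtain ⟨C, hC, hsum⟩ := rpow_sum_le (s := r - 2) (by linarith)
  refine ⟨C, hC, fun t ht => ?_⟩
  have ht0 : 0 ≤ t := by linarith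
  rw [ENNReal.tsum_prod', ENNReal.tsum_comm]
  set T : ℕ → ℝ := fun k => (t * ((k : ℝ) + 1) ^ (-(1 - α))) ^ (1 / α) with hT
  have hT0 : ∀ k, 0 ≤ T k := fun k => by positivity
  have inner : ∀ k : ℕ, ∑' n : ℕ, (if triangleThreshold α (n, k) ≤ t then
      triangleWeight r (n, k) else 0) ≤ if k < ⌊t⌋₊ then ENNReal.ofReal
        (C * (t ^ ((r - 1) / α) * ((k : ℝ) + 1) ^ (-((1 - α) * ((r - 1) / α))))) else 0 := by
    intro k
    split_ifs with hk
    · rw [← threshold_root_rpow ht0]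
      calc _ ≤ ∑' n : ℕ, if n ∈ Finset.range ⌊T k⌋₊ then
              ENNReal.ofReal (((n : ℝ) + 1) ^ (r - 2)) else 0 := by
            refine ENNReal.tsum_le_tsum fun n => ?_
            split_ifs with h1 h2
            · unfold triangleWeight; split_ifs <;> simp
            · rw [triangleThreshold_le_iff hα0 ht0] at h1
              exact absurd (Finset.mem_range.2 (Nat.le_floor (by push_cast; exact h1))) h2
            · simp
            · simp
        _ = ∑ n ∈ Finset.range ⌊T k⌋₊, ENNReal.ofReal (((n : ℝ) + 1) ^ (r - 2)) := by
            rw [tsum_eq_sum (s := Finset.range ⌊T k⌋₊) (fun n hn => by simp only [hn, if_false])]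
            exact Finset.sum_congr rfl fun n hn => by simp only [hn, if_true]
        _ ≤ _ := by
            rw [← ENNReal.ofReal_sum_of_nonneg fun n _ => by positivity]
            refine ENNReal.ofReal_le_ofReal ((hsum _).trans ?_)
            rw [show r - 2 + 1 = r - 1 by ring]
            gcongr
            exact Nat.floor_le (hT0 k)
    · rw [nonpos_iff_eq_zero, ENNReal.tsum_eq_zero]
      intro n
      split_ifs with h1
      · unfold triangleWeight
        rw [if_neg]
        intro hkn
        apply hk
        refine Nat.le_floor ?_
        have hkn' : (k : ℝ) + 1 ≤ n + 1 := by
          have : (k : ℝ) ≤ n := by exact_mod_cast hkn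
          linarith
        push_cast
        calc (k : ℝ) + 1 = (k + 1) ^ α * (k + 1) ^ (1 - α) := by
              rw [← Real.rpow_add (by positivity)]; simp
          _ ≤ (n + 1) ^ α * (k + 1) ^ (1 - α) := by gcongr
          _ ≤ t := h1
      · rfl
  refine (ENNReal.tsum_le_tsum inner).trans ?_
  rw [tsum_eq_sum (s := Finset.range ⌊t⌋₊) (fun n hn => by
    rw [if_neg (by simpa using hn)])]
  rw [negPowerSum, Finset.mul_sum, Finset.mul_sum, ENNReal.ofReal_sum_of_nonneg]
  · exact Finset.sum_le_sum fun k hk => by rw [if_pos (Finset.mem_range.1 hk)]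
  · intro k _; positivity

/-- It will be used with exponent r - 2, which may have either sign; a power varies only by a
constant factor on [T/2, T]. -/
theorem exists_le_rpow_of_half_le (s : ℝ) :
    ∃ m : ℝ, 0 < m ∧ ∀ T x : ℝ, 0 < T → T / 2 ≤ x → x ≤ T → m * T ^ s ≤ x ^ s := by
  rcases le_or_gt 0 s with hs | hs
  · refine ⟨(1 / 2) ^ s, by positivity, fun T x hT h1 _ => ?_⟩
    rw [← Real.mul_rpow (by norm_num) hT.le]
    exact Real.rpow_le_rpow (by positivity) (by linarith) hs
  · exact ⟨1, one_pos, fun T x hT h1 h2 => by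
      rw [one_mul]; exact Real.rpow_le_rpow_of_nonpos (by linarith) h2 hs.le⟩

/-- When 4(k+1) ≤ t, the largest admissible n + 1, called `T k`, is at least t. Indices n + 1 in the
upper half of [0, T k] then satisfy k ≤ n automatically, and there are at least T k/2 - 1 ≥ T k/4 of
them because T k ≥ 4. -/
theorem le_count (hα0 : 0 < α) (hα1 : α ≤ 1) :
    ∃ C : ℝ, 0 < C ∧ ∀ t : ℝ, 4 ≤ t →
      ENNReal.ofReal (C * (t ^ ((r - 1) / α) *
          negPowerSum ((1 - α) * ((r - 1) / α)) ⌊t / 4⌋₊)) ≤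
      ∑' i, (if triangleThreshold α i ≤ t then triangleWeight r i else 0) := by
  obtain ⟨m, hm, hpow⟩ := exists_le_rpow_of_half_le (r - 2)
  refine ⟨m / 4, by positivity, fun t ht => ?_⟩
  have ht0 : 0 ≤ t := by linarith
  rw [ENNReal.tsum_prod', ENNReal.tsum_comm]
  set T : ℕ → ℝ := fun k => (t * ((k : ℝ) + 1) ^ (-(1 - α))) ^ (1 / α) with hT
  rw [negPowerSum, Finset.mul_sum, Finset.mul_sum,
    ENNReal.ofReal_sum_of_nonneg (fun k _ => by positivity)]
  refine le_trans (Finset.sum_le_sum fun k hk => ?_) (ENNReal.sum_le_tsum (Finset.range ⌊t / 4⌋₊))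
  have hk4 : ((k : ℝ) + 1) * 4 ≤ t := by
    have h1 := Nat.floor_le (show 0 ≤ t / 4 by positivity)
    have h2 : ((k + 1 : ℕ) : ℝ) ≤ ⌊t / 4⌋₊ := by exact_mod_cast Finset.mem_range.1 hk
    push_cast at h2
    linarith
  have hk0 : (0 : ℝ) ≤ k := Nat.cast_nonneg k
  have hTt : t ≤ T k := by
    rw [hT, one_div]
    dsimp only
    rw [Real.le_rpow_inv_iff_of_pos ht0 (by positivity) hα0]
    calc t ^ α = t * t ^ (-(1 - α)) := by
          nth_rewrite 2 [← Real.rpow_one t]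
          rw [← Real.rpow_add (by linarith)]; congr 1; ring
      _ ≤ _ := mul_le_mul_of_nonneg_left
          (Real.rpow_le_rpow_of_nonpos (by positivity) (by linarith) (by linarith)) ht0
  have hTpos : 0 < T k := by linarith
  rw [← threshold_root_rpow ht0]
  refine le_trans ?_ (ENNReal.sum_le_tsum (Finset.Ico ⌊T k / 2⌋₊ ⌊T k⌋₊))
  have hterm : ∀ n ∈ Finset.Ico ⌊T k / 2⌋₊ ⌊T k⌋₊, ENNReal.ofReal (m * T k ^ (r - 2)) ≤
      if triangleThreshold α (n, k) ≤ t then triangleWeight r (n, k) else 0 := by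
    intro n hn
    obtain ⟨hn1, hn2⟩ := Finset.mem_Ico.1 hn
    have h1 : T k / 2 < n + 1 := (Nat.floor_lt (by positivity)).1 (Nat.lt_succ_of_le hn1) |>.trans_eq
      (by push_cast; ring)
    have h2 : (n : ℝ) + 1 ≤ T k := by
      have : ((n + 1 : ℕ) : ℝ) ≤ ⌊T k⌋₊ := by exact_mod_cast hn2
      push_cast at this
      exact this.trans (Nat.floor_le hTpos.le)
    have h3 : k ≤ n := by
      refine le_trans (Nat.le_floor ?_) hn1
      linarith
    rw [if_pos ((triangleThreshold_le_iff hα0 ht0 n k).2 h2), triangleWeight, if_pos h3]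
    exact ENNReal.ofReal_le_ofReal (hpow _ _ hTpos h1.le h2)
  refine le_trans ?_ (Finset.card_nsmul_le_sum _ _ _ hterm)
  rw [nsmul_eq_mul, ← ENNReal.ofReal_natCast, ← ENNReal.ofReal_mul (by positivity)]
  apply ENNReal.ofReal_le_ofReal
  rw [Nat.card_Ico, Nat.cast_sub (Nat.floor_le_floor (by linarith))]
  have h1 := Nat.sub_one_lt_floor (T k)
  have h2 := Nat.floor_le (show 0 ≤ T k / 2 by positivity)
  calc m / 4 * T k ^ (r - 1) = T k / 4 * (m * T k ^ (r - 2)) := by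
        rw [show r - 1 = (r - 2) + 1 by ring, Real.rpow_add hTpos, Real.rpow_one]; ring
    _ ≤ _ := by gcongr; linarith

end

/-! ### The Choquet integral and the double series -/

namespace SublinearExpectationSpace

variable {Ω : Type*} [MeasurableSpace Ω] {S : SublinearExpectationSpace Ω}

/-- The double series `∑_{k ≤ n} n^(r-2) V(|X| > c (n^α k^(1-α))^p)`. -/
noncomputable def triangleSum (S : SublinearExpectationSpace Ω) (X : Ω → ℝ) (r p α c : ℝ) :
    ℝ≥0∞ :=
  ∑' i, triangleWeight r i *
    ENNReal.ofReal (S.prob {ω | c * triangleThreshold α i ^ p < |X ω|})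

/-- For Z ≥ 0 the events at negative levels are all of Ω, whose capacity is 1, so the negative half
vanishes. -/
theorem choquet_lt_top_iff {Z : Ω → ℝ} (hZ : Measurable Z) (hZ0 : ∀ ω, 0 ≤ Z ω) :
    S.choquet Z < ⊤ ↔
      ∫⁻ x in Set.Ioi (0 : ℝ), ENNReal.ofReal (S.prob {ω | x < Z ω}) < ⊤ := by
  have hm : ∀ x, MeasurableSet {ω | x < Z ω} := fun x => measurableSet_lt measurable_const hZ
  have h2 : ∫⁻ x in Set.Iio (0 : ℝ), (1 - S.capacity {ω | x < Z ω}) = 0 := by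
    rw [MeasureTheory.setLIntegral_congr_fun (g := fun _ => 0) measurableSet_Iio]
    · simp
    · intro x hx
      have : {ω | x < Z ω} = Set.univ := Set.eq_univ_of_forall fun ω => lt_of_lt_of_le hx (hZ0 ω)
      simp [this, capacity_eq MeasurableSet.univ, prob_univ]
  rw [choquet, h2]
  simp only [capacity_eq (hm _), EReal.coe_ennreal_zero, sub_zero]
  rw [lt_top_iff_ne_top, lt_top_iff_ne_top, Ne, EReal.coe_ennreal_eq_top_iff]

theorem prob_lt_antitone {Z : Ω → ℝ} (hZ : Measurable Z) :
    Antitone fun x => S.prob {ω | x < Z ω} := fun _ _ hxy =>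
  prob_mono (measurableSet_lt measurable_const hZ) (measurableSet_lt measurable_const hZ)
    fun _ hω => lt_of_le_of_lt hxy hω

/-- As φ is strictly increasing, |X| > c τ^p is the event φ(|X|) > φ(c τ^p). The double series thus
samples the antitone tail of φ(|X|) at the points φ(c τ^p), and the number of those below φ(c t^p)
is the weighted count at t. The two growth hypotheses say that this count is comparable with φ(c
t^p) itself. -/
theorem choquet_lt_top_iff_triangleSum {X : Ω → ℝ} (hX : X ∈ S.H) {r p α c : ℝ} (hr : 1 < r)
    (hp : 0 < p) (hα0 : 0 < α) (hα1 : α ≤ 1) (hc : 0 < c) {φ : ℝ → ℝ}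
    (hφm : StrictMonoOn φ (Set.Ici 0)) (hφc : Continuous fun x => φ |x|) (hφ0 : φ 0 = 0)
    (hφt : Filter.Tendsto φ Filter.atTop Filter.atTop)
    (h1 : ∃ C, 0 < C ∧ ∀ t, 1 ≤ t →
      t ^ ((r - 1) / α) * negPowerSum ((1 - α) * ((r - 1) / α)) ⌊t⌋₊ ≤ C * φ (c * t ^ p))
    (h2 : ∃ C, 0 < C ∧ ∀ t, 4 ≤ t → φ (c * t ^ p) ≤
      C * (t ^ ((r - 1) / α) * negPowerSum ((1 - α) * ((r - 1) / α)) ⌊t / 4⌋₊)) :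
    S.choquet (fun ω => φ |X ω|) < ⊤ ↔ S.triangleSum X r p α c < ⊤ := by
  have hXm := S.measurable_of_mem X hX
  have hZ : Measurable fun ω => φ |X ω| := hφc.measurable.comp hXm
  have hφnn : ∀ x, 0 ≤ x → 0 ≤ φ x := fun x hx =>
    hφ0 ▸ hφm.monotoneOn (Set.self_mem_Ici) hx hx
  rw [choquet_lt_top_iff hZ fun ω => hφnn _ (abs_nonneg _)]
  have hv := prob_lt_antitone (S := S) hZ
  have hv0 : ∀ x, 0 ≤ S.prob {ω | x < φ |X ω|} := fun x =>
    prob_nonneg (measurableSet_lt measurable_const hZ)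
  have hv1 : ∀ x, S.prob {ω | x < φ |X ω|} ≤ 1 := fun x =>
    prob_le_one (measurableSet_lt measurable_const hZ)
  have hthr : ∀ i, 1 ≤ triangleThreshold α i := one_le_triangleThreshold hα0.le hα1
  have hthr0 : ∀ i, 0 ≤ triangleThreshold α i := fun i => zero_le_one.trans (hthr i)
  have hle : ∀ s t : ℝ, 0 ≤ s → 0 ≤ t → (φ (c * s ^ p) ≤ φ (c * t ^ p) ↔ s ≤ t) :=
    fun s t hs ht => by
      rw [hφm.le_iff_le (Set.mem_Ici.2 (by positivity)) (Set.mem_Ici.2 (by positivity)),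
        mul_le_mul_iff_right₀ hc, Real.rpow_le_rpow_iff hs ht hp]
  set y : ℕ × ℕ → ℝ := fun i => φ (c * triangleThreshold α i ^ p) with hy
  have hvy : S.triangleSum X r p α c = ∑' i, triangleWeight r i *
      ENNReal.ofReal (S.prob {ω | y i < φ |X ω|}) := by
    unfold triangleSum
    congr! 6 with i
    ext ω
    exact (hφm.lt_iff_lt (Set.mem_Ici.2 (mul_nonneg hc.le (Real.rpow_nonneg (hthr0 i) p)))
      (Set.mem_Ici.2 (abs_nonneg (X _)))).symm
  rw [hvy]
  constructor
  · intro hfin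
    obtain ⟨C, hC, h1⟩ := h1
    obtain ⟨C', hC', hcount⟩ := count_le hr hα0
    have := tsum_mul_le_lintegral_of_count_le hv hv0 hv1 (triangleWeight r) y
      (C := ENNReal.ofReal (C' * C)) (D := 0) ENNReal.ofReal_ne_top (fun j => ?_)
    · exact this.trans_lt (by
        rw [add_zero]; exact ENNReal.mul_lt_top ENNReal.ofReal_lt_top hfin)
    · simp only [hy, hle _ _ (hthr0 _) (hthr0 _), add_zero]
      rw [← ENNReal.ofReal_mul (by positivity)]
      refine (hcount _ (hthr j)).trans (ENNReal.ofReal_le_ofReal ?_)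
      rw [mul_assoc]
      exact mul_le_mul_of_nonneg_left (h1 _ (hthr j)) hC'.le
  · intro hfin
    obtain ⟨C, hC, h2⟩ := h2
    obtain ⟨C', hC', hcount⟩ := le_count (r := r) hα0 hα1
    have := lintegral_le_tsum_mul_of_le_count hv hv0 hv1 (triangleWeight r) y
      -- The additive term absorbs levels with t < 4, where the lower count is not available.
      (C := ENNReal.ofReal (C / C')) (D := ENNReal.ofReal (φ (c * 4 ^ p)))
      ENNReal.ofReal_ne_top (fun x hx => ?_)
    · exact this.trans_lt (ENNReal.add_lt_top.2
        ⟨ENNReal.mul_lt_top ENNReal.ofReal_lt_top hfin, ENNReal.ofReal_lt_top⟩)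
    -- Every positive level has the form φ(c t^p): the intermediate value theorem inverts φ, then
    -- the power is inverted.
    · obtain ⟨s, hs, rfl⟩ : ∃ s, 0 ≤ s ∧ φ s = x := by
        obtain ⟨b, hb⟩ := ((hφt.eventually_ge_atTop x).and
          (Filter.eventually_ge_atTop 0)).exists
        obtain ⟨s, hs, hsx⟩ := intermediate_value_Icc hb.2 hφc.continuousOn
          (show x ∈ Set.Icc (φ |0|) (φ |b|) by
            rw [abs_zero, hφ0, abs_of_nonneg hb.2]; exact ⟨hx.le, hb.1⟩)
        exact ⟨s, hs.1, by simpa only [abs_of_nonneg hs.1] using hsx⟩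
      obtain ⟨t, ht, rfl⟩ : ∃ t, 0 ≤ t ∧ c * t ^ p = s :=
        ⟨(s / c) ^ (p⁻¹), by positivity, by
          rw [Real.rpow_inv_rpow (by positivity) hp.ne']; field_simp⟩
      rcases le_or_gt 4 t with h4 | h4
      · simp only [hy, hle _ _ (hthr0 _) ht]
        refine le_trans ?_ le_self_add
        calc _ ≤ ENNReal.ofReal (C / C' * (C' * (t ^ ((r - 1) / α) *
              negPowerSum ((1 - α) * ((r - 1) / α)) ⌊t / 4⌋₊))) := by
              refine ENNReal.ofReal_le_ofReal ((h2 t h4).trans_eq ?_)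
              field_simp
          _ ≤ _ := by
              rw [ENNReal.ofReal_mul (by positivity)]
              gcongr
              exact hcount t h4
      · refine le_trans (ENNReal.ofReal_le_ofReal ?_) le_add_self
        exact (hle _ _ ht (by norm_num)).2 h4.le

end SublinearExpectationSpace

/-! ### Growth of the partial sums of k^(-e) -/

theorem one_le_negPowerSum (e : ℝ) {N : ℕ} (hN : 1 ≤ N) : 1 ≤ negPowerSum e N := by
  have := Finset.single_le_sum (f := fun k : ℕ => ((k : ℝ) + 1) ^ (-e))
    (fun i _ => by positivity) (Finset.mem_range.2 hN)
  simpa [negPowerSum] using this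

theorem exists_negPowerSum_le {e : ℝ} (he : 1 < e) : ∃ C, 0 < C ∧ ∀ N, negPowerSum e N ≤ C := by
  have hs : Summable fun k : ℕ => ((k : ℝ) + 1) ^ (-e) := by
    have := (summable_nat_add_iff 1).2 (Real.summable_nat_rpow.2 (show -e < -1 by linarith))
    simpa using this
  refine ⟨∑' k : ℕ, ((k : ℝ) + 1) ^ (-e), ?_, fun N => hs.sum_le_tsum _ fun _ _ => by positivity⟩
  exact hs.tsum_pos (fun _ => by positivity) 0 (by norm_num)

theorem negPowerSum_one (N : ℕ) : negPowerSum 1 N = (harmonic N : ℝ) := by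
  simp [negPowerSum, harmonic, Real.rpow_neg_one]

theorem floor_div_four_bounds {t : ℝ} (ht : 4 ≤ t) :
    1 ≤ ⌊t / 4⌋₊ ∧ t / 8 ≤ ⌊t / 4⌋₊ ∧ t / 4 < ⌊t / 4⌋₊ + 1 := by
  have h1 : 1 ≤ ⌊t / 4⌋₊ := Nat.le_floor (by push_cast; linarith)
  have h2 := Nat.lt_floor_add_one (t / 4)
  refine ⟨h1, ?_, h2⟩
  have : (1 : ℝ) ≤ ⌊t / 4⌋₊ := by exact_mod_cast h1
  linarith

theorem rpow_le_negPowerSum {e : ℝ} (he : 0 ≤ e) (N : ℕ) (hN : 1 ≤ N) :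
    (N : ℝ) ^ (1 - e) ≤ negPowerSum e N := by
  have hN' : (0 : ℝ) < N := by exact_mod_cast hN
  calc (N : ℝ) ^ (1 - e) = ∑ _k ∈ Finset.range N, (N : ℝ) ^ (-e) := by
        rw [Finset.sum_const, Finset.card_range, nsmul_eq_mul, sub_eq_add_neg,
          Real.rpow_add hN', Real.rpow_one]
    _ ≤ _ := Finset.sum_le_sum fun k hk =>
        Real.rpow_le_rpow_of_nonpos (by positivity)
          (by exact_mod_cast Finset.mem_range.1 hk) (by linarith)

/-- The N terms of the sum are each at least N^(-e), so its order is N^(1-e). The constant 8 comes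
from ⌊t/4⌋ ≥ t/8 for t ≥ 4. -/
theorem negPowerSum_lt_one_bounds {e : ℝ} (he0 : 0 ≤ e) (he : e < 1) :
    (∃ C, 0 < C ∧ ∀ t : ℝ, 1 ≤ t → negPowerSum e ⌊t⌋₊ ≤ C * t ^ (1 - e)) ∧
    ∃ C, 0 < C ∧ ∀ t : ℝ, 4 ≤ t → t ^ (1 - e) ≤ C * negPowerSum e ⌊t / 4⌋₊ := by
  constructor
  · obtain ⟨C, hC, h⟩ := rpow_sum_le (s := -e) (by linarith)
    refine ⟨C, hC, fun t ht => (h _).trans ?_⟩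
    rw [show -e + 1 = 1 - e by ring]
    gcongr
    exact Nat.floor_le (by linarith)
  · refine ⟨8 ^ (1 - e), by positivity, fun t ht => ?_⟩
    obtain ⟨h1, h2, -⟩ := floor_div_four_bounds ht
    calc t ^ (1 - e) = 8 ^ (1 - e) * (t / 8) ^ (1 - e) := by
          rw [← Real.mul_rpow (by norm_num) (by linarith)]; congr 1; ring
      _ ≤ 8 ^ (1 - e) * (⌊t / 4⌋₊ : ℝ) ^ (1 - e) := by
          gcongr
      _ ≤ _ := by gcongr; exact rpow_le_negPowerSum he0 _ h1

/-- Both sides are log t up to constant factors and bounded additive errors. The errors are absorbed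
because log(1 + c t^p) ≥ log(1 + c) > 0 and the harmonic sum is at least 1. -/
theorem negPowerSum_one_bounds {c p : ℝ} (hc : 0 < c) (hp : 0 < p) :
    (∃ C, 0 < C ∧ ∀ t : ℝ, 1 ≤ t → negPowerSum 1 ⌊t⌋₊ ≤ C * Real.log (1 + c * t ^ p)) ∧
    ∃ C, 0 < C ∧ ∀ t : ℝ, 4 ≤ t →
      Real.log (1 + c * t ^ p) ≤ C * negPowerSum 1 ⌊t / 4⌋₊ := by
  have hlc : 0 < Real.log (1 + c) := Real.log_pos (by linarith)
  constructor
  · refine ⟨(1 + |Real.log c| / p) / Real.log (1 + c) + 1 / p, by positivity, fun t ht => ?_⟩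
    have htp : 1 ≤ t ^ p := Real.one_le_rpow ht hp.le
    have hl : Real.log (1 + c) ≤ Real.log (1 + c * t ^ p) :=
      Real.log_le_log (by positivity) (by nlinarith)
    have hl2 : Real.log c + p * Real.log t ≤ Real.log (1 + c * t ^ p) := by
      rw [← Real.log_rpow (by linarith), ← Real.log_mul hc.ne' (by positivity)]
      exact Real.log_le_log (by positivity) (by linarith)
    have hf : 1 ≤ ⌊t⌋₊ := Nat.le_floor (by simpa using ht)
    have hfl : Real.log (⌊t⌋₊ : ℝ) ≤ Real.log t :=
      Real.log_le_log (by exact_mod_cast hf) (Nat.floor_le (by linarith))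
    rw [negPowerSum_one]
    have hh := harmonic_le_one_add_log ⌊t⌋₊
    have hlt : Real.log t ≤ (Real.log (1 + c * t ^ p) + |Real.log c|) / p := by
      rw [le_div_iff₀ hp]
      linarith [neg_abs_le (Real.log c)]
    have h3 : 1 + |Real.log c| / p ≤
        (1 + |Real.log c| / p) / Real.log (1 + c) * Real.log (1 + c * t ^ p) := by
      rw [div_mul_eq_mul_div, le_div_iff₀ hlc]
      gcongr
    calc (harmonic ⌊t⌋₊ : ℝ) ≤ 1 + (Real.log (1 + c * t ^ p) + |Real.log c|) / p := by linarith
      _ = (1 + |Real.log c| / p) + 1 / p * Real.log (1 + c * t ^ p) := by ring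
      _ ≤ _ := by rw [add_mul]; gcongr
  · refine ⟨Real.log (1 + c) + p * (1 + Real.log 4), by
      have := Real.log_pos (show (1 : ℝ) < 4 by norm_num); positivity, fun t ht => ?_⟩
    obtain ⟨h1, -, h3⟩ := floor_div_four_bounds ht
    have htp : 1 ≤ t ^ p := Real.one_le_rpow (by linarith) hp.le
    have hN := one_le_negPowerSum 1 h1
    have hl4 := Real.log_pos (show (1 : ℝ) < 4 by norm_num)
    have hl : Real.log (1 + c * t ^ p) ≤ Real.log (1 + c) + p * Real.log t := by
      rw [← Real.log_rpow (by linarith), ← Real.log_mul (by positivity) (by positivity)]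
      exact Real.log_le_log (by positivity) (by nlinarith)
    have hh := log_add_one_le_harmonic ⌊t / 4⌋₊
    rw [← negPowerSum_one] at hh
    have hlt : Real.log t ≤ negPowerSum 1 ⌊t / 4⌋₊ + Real.log 4 := by
      have : Real.log (t / 4) ≤ Real.log (⌊t / 4⌋₊ + 1) :=
        Real.log_le_log (by positivity) h3.le
      rw [Real.log_div (by linarith) (by norm_num)] at this
      push_cast at hh
      linarith
    have h5 : Real.log t ≤ (1 + Real.log 4) * negPowerSum 1 ⌊t / 4⌋₊ := by nlinarith
    have h6 : Real.log (1 + c) ≤ Real.log (1 + c) * negPowerSum 1 ⌊t / 4⌋₊ :=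
      le_mul_of_one_le_right hlc.le hN
    have h7 := mul_le_mul_of_nonneg_left h5 hp.le
    linarith

/-! ### Pointwise bounds for truncated exponentials and moments -/

/-- Truncation of `x` to the interval `[-δ, δ]`. -/
noncomputable def clamp (δ x : ℝ) : ℝ := max (-δ) (min x δ)

theorem clamp_of_abs_le {δ x : ℝ} (h : |x| ≤ δ) : clamp δ x = x := by
  rw [clamp, min_eq_left (abs_le.1 h).2, max_eq_right (abs_le.1 h).1]

theorem clamp_le {δ : ℝ} (hδ : 0 ≤ δ) (x : ℝ) : clamp δ x ≤ δ :=
  max_le (by linarith) (min_le_right _ _)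

theorem abs_clamp_sub_clamp_le (δ x y : ℝ) : |clamp δ x - clamp δ y| ≤ |x - y| := by
  unfold clamp
  refine (abs_max_sub_max_le_max _ _ _ _).trans ?_
  rw [sub_self, abs_zero, max_eq_right (abs_nonneg _)]
  refine (abs_min_sub_min_le_max _ _ _ _).trans ?_
  rw [sub_self, abs_zero, max_eq_left (abs_nonneg _)]

theorem exp_le_one_add_id_add_sq_mul (x : ℝ) :
    Real.exp x ≤ 1 + x + x ^ 2 * Real.exp |x| := by
  have h := Complex.norm_exp_sub_sum_le_norm_mul_exp (x : ℂ) 2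
  have e : Complex.exp x - ∑ m ∈ Finset.range 2, (x : ℂ) ^ m / (m.factorial : ℂ) =
      ((Real.exp x - (1 + x) : ℝ) : ℂ) := by
    simp [Finset.sum_range_succ]
  rw [e, Complex.norm_real, Complex.norm_real, Real.norm_eq_abs, Real.norm_eq_abs, sq_abs] at h
  linarith [le_abs_self (Real.exp x - (1 + x))]

theorem exp_le_one_add_abs_mul (x : ℝ) : Real.exp x ≤ 1 + |x| * Real.exp |x| := by
  have h := Complex.norm_exp_sub_sum_le_norm_mul_exp (x : ℂ) 1
  have e : Complex.exp x - ∑ m ∈ Finset.range 1, (x : ℂ) ^ m / (m.factorial : ℂ) =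
      ((Real.exp x - 1 : ℝ) : ℂ) := by
    simp
  rw [e, Complex.norm_real, Complex.norm_real, Real.norm_eq_abs, Real.norm_eq_abs, pow_one] at h
  linarith [le_abs_self (Real.exp x - 1)]

/-- exp is Lipschitz on a half-line bounded above; this puts exponentials of truncated variables
into `H`. -/
theorem abs_exp_sub_exp_le {u w M : ℝ} (hu : u ≤ M) (hw : w ≤ M) :
    |Real.exp u - Real.exp w| ≤ Real.exp M * |u - w| := by
  wlog h : w ≤ u generalizing u w
  · rw [abs_sub_comm, abs_sub_comm u]
    exact this hw hu (not_le.1 h).le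
  rw [abs_of_nonneg (sub_nonneg.2 (Real.exp_le_exp.2 h)), abs_of_nonneg (sub_nonneg.2 h)]
  have h1 := Real.add_one_le_exp (w - u)
  have h2 : Real.exp w = Real.exp u * Real.exp (w - u) := by rw [← Real.exp_add]; ring_nf
  have h3 := Real.exp_le_exp.2 hu
  have h4 := Real.exp_pos u
  rw [h2]
  nlinarith [mul_le_mul_of_nonneg_right h3 (sub_nonneg.2 h)]

/-- The constant in the bounds for the exponential of a truncated variable. -/
noncomputable def expConst (t δ : ℝ) : ℝ := (t + t ^ 2) * Real.exp (t * δ) / δ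

section

variable {t δ q : ℝ}

theorem expConst_nonneg (ht : 0 ≤ t) (hδ : 0 < δ) : 0 ≤ expConst t δ := by
  unfold expConst; positivity

theorem mul_exp_le_expConst (ht : 0 ≤ t) (hδ : 0 < δ) (hδ1 : δ ≤ 1) :
    t * Real.exp (t * δ) ≤ expConst t δ := by
  rw [expConst, le_div_iff₀ hδ]
  calc t * Real.exp (t * δ) * δ ≤ t * Real.exp (t * δ) * 1 := by gcongr
    _ ≤ _ := by rw [mul_one]; gcongr; nlinarith [sq_nonneg t]

theorem exp_clamp_le_of_lt (ht : 0 ≤ t) (hδ : 0 < δ) {x : ℝ} (hx : δ < |x|) :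
    Real.exp (t * clamp δ x) ≤ 1 + t * |x| * Real.exp (t * δ) := by
  have h1 : Real.exp (t * clamp δ x) ≤ Real.exp (t * δ) :=
    Real.exp_le_exp.2 (mul_le_mul_of_nonneg_left (clamp_le hδ.le x) ht)
  have h2 := exp_le_one_add_abs_mul (t * δ)
  rw [abs_of_nonneg (by positivity)] at h2
  have h3 : t * δ * Real.exp (t * δ) ≤ t * |x| * Real.exp (t * δ) := by gcongr
  linarith

/-- The truncation has absolute value min(|x|, δ), which is at most |x|^q when q ≤ 1 and δ ≤ 1. A
first-order bound on exp therefore suffices. -/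
theorem exp_clamp_le_of_le_one (ht : 0 ≤ t) (hδ : 0 < δ) (hδ1 : δ ≤ 1) (hq0 : 0 < q)
    (hq : q ≤ 1) (x : ℝ) : Real.exp (t * clamp δ x) ≤ 1 + expConst t δ * |x| ^ q := by
  have hD := mul_exp_le_expConst ht hδ hδ1
  have hmain : Real.exp (t * clamp δ x) ≤ 1 + t * min |x| δ * Real.exp (t * δ) := by
    rcases le_or_gt |x| δ with hx | hx
    · rw [clamp_of_abs_le hx, min_eq_left hx]
      have := exp_le_one_add_abs_mul (t * x)
      rw [abs_mul, abs_of_nonneg ht] at this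
      refine this.trans ?_
      gcongr
    · have h1 : Real.exp (t * clamp δ x) ≤ Real.exp (t * δ) :=
        Real.exp_le_exp.2 (mul_le_mul_of_nonneg_left (clamp_le hδ.le x) ht)
      have h2 := exp_le_one_add_abs_mul (t * δ)
      rw [abs_of_nonneg (by positivity)] at h2
      rw [min_eq_right hx.le]
      linarith
  have hle : min |x| δ ≤ |x| ^ q := by
    rcases le_or_gt |x| 1 with h | h
    · exact (min_le_left _ _).trans (Real.self_le_rpow_of_le_one (abs_nonneg x) h hq)
    · exact ((min_le_right _ _).trans hδ1).trans (Real.one_le_rpow h.le hq0.le)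
  refine hmain.trans ?_
  have h0 : 0 ≤ |x| ^ q := by positivity
  have : t * min |x| δ * Real.exp (t * δ) ≤ t * |x| ^ q * Real.exp (t * δ) := by gcongr
  nlinarith [mul_le_mul_of_nonneg_right hD h0]

/-- The linear term carries the untruncated x, whose mean vanishes. Up to δ this is the second-order
Taylor bound. Beyond δ, a linear term is dominated by |x|^q because |x|^(q-1) ≥ δ, which is where
the division by δ in `expConst` comes from. -/
theorem exp_clamp_le_of_one_lt (ht : 0 ≤ t) (hδ : 0 < δ) (hδ1 : δ ≤ 1) (hq : 1 < q)
    (hq2 : q ≤ 2) (x : ℝ) :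
    Real.exp (t * clamp δ x) ≤ 1 + t * x + expConst t δ * |x| ^ q := by
  have h0 : 0 ≤ |x| ^ q := by positivity
  rcases le_or_gt |x| δ with hx | hx
  · rw [clamp_of_abs_le hx]
    have h1 := exp_le_one_add_id_add_sq_mul (t * x)
    rw [abs_mul, abs_of_nonneg ht] at h1
    have h2 : |x| ^ 2 ≤ |x| ^ q := by
      rcases (abs_nonneg x).eq_or_lt with h | h
      · rw [← h, Real.zero_rpow (by linarith)]; norm_num
      · rw [← Real.rpow_natCast]
        exact Real.rpow_le_rpow_of_exponent_ge h (hx.trans hδ1) (by simpa using hq2)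
    have h3 : t ^ 2 * Real.exp (t * δ) ≤ expConst t δ := by
      rw [expConst, le_div_iff₀ hδ]
      calc t ^ 2 * Real.exp (t * δ) * δ ≤ t ^ 2 * Real.exp (t * δ) * 1 := by gcongr
        _ ≤ _ := by rw [mul_one]; gcongr; linarith
    calc Real.exp (t * x) ≤ 1 + t * x + (t * x) ^ 2 * Real.exp (t * |x|) := h1
      _ ≤ 1 + t * x + t ^ 2 * |x| ^ q * Real.exp (t * δ) := by
          rw [mul_pow, ← sq_abs x]; gcongr
      _ = 1 + t * x + t ^ 2 * Real.exp (t * δ) * |x| ^ q := by ring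
      _ ≤ _ := by gcongr
  · have hxpos : 0 < |x| := hδ.trans hx
    have h2 : t * |x| * Real.exp (t * δ) ≤ expConst t δ * |x| ^ q := by
      have hδq : δ ≤ |x| ^ (q - 1) :=
        (Real.self_le_rpow_of_le_one hδ.le hδ1 (by linarith)).trans
          (Real.rpow_le_rpow hδ.le hx.le (by linarith))
      have e : |x| ^ q = |x| * |x| ^ (q - 1) := by
        rw [Real.rpow_sub_one hxpos.ne']; field_simp
      rw [expConst, e, div_mul_eq_mul_div, le_div_iff₀ hδ]
      have ht2 : t ≤ t + t ^ 2 := by nlinarith [sq_nonneg t]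
      calc t * |x| * Real.exp (t * δ) * δ ≤ (t + t ^ 2) * |x| * Real.exp (t * δ) * |x| ^ (q - 1) := by
            gcongr
        _ = _ := by ring
    rcases le_or_gt 0 x with hx0 | hx0
    · have h1 := exp_clamp_le_of_lt ht hδ hx
      have : 0 ≤ t * x := by positivity
      linarith
    · have hc : clamp δ x ≤ 0 := by
        unfold clamp
        exact max_le (by linarith) ((min_le_left _ _).trans hx0.le)
      have h1 : Real.exp (t * clamp δ x) ≤ 1 :=
        Real.exp_le_one_iff.2 (mul_nonpos_of_nonneg_of_nonpos ht hc)
      have h3 : t * |x| ≤ t * |x| * Real.exp (t * δ) :=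
        le_mul_of_one_le_right (by positivity) (Real.one_le_exp (by positivity))
      have h4 : t * x = -(t * |x|) := by rw [abs_of_neg hx0]; ring
      linarith

end

/-- The moment function `max (|x|, 1)^q`. -/
noncomputable def momentFun (q x : ℝ) : ℝ := max |x| 1 ^ q

theorem momentFun_nonneg (q x : ℝ) : 0 ≤ momentFun q x := by unfold momentFun; positivity

theorem abs_rpow_le_momentFun {q : ℝ} (hq : 0 ≤ q) (x : ℝ) : |x| ^ q ≤ momentFun q x :=
  Real.rpow_le_rpow (abs_nonneg x) (le_max_left _ _) hq

/-- Replacing |x| by max(|x|, 1) removes the singularity of |x|^q at 0 for q < 1. For u ≥ w ≥ 1 and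
q ≤ 2, u^q (1 - (w/u)^q) ≤ u² (1 - (w/u)²), so the increment is at most that of the square. -/
theorem abs_momentFun_sub_le {q : ℝ} (hq2 : q ≤ 2) (x y : ℝ) (hq : 0 ≤ q) :
    |momentFun q x - momentFun q y| ≤ 2 * (1 + |x| ^ 1 + |y| ^ 1) * |x - y| := by
  have key : ∀ u w : ℝ, 1 ≤ w → w ≤ u → u ^ q - w ^ q ≤ (u + w) * (u - w) := by
    intro u w hw hwu
    have hu : 0 < u := by linarith
    have h1 : (w / u) ^ 2 ≤ (w / u) ^ q := by
      rw [← Real.rpow_natCast]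
      exact Real.rpow_le_rpow_of_exponent_ge (by positivity) ((div_le_one hu).2 hwu)
        (by simpa using hq2)
    have h2 : u ^ q ≤ u ^ 2 := by
      rw [← Real.rpow_natCast]
      exact Real.rpow_le_rpow_of_exponent_le (by linarith) (by simpa using hq2)
    have h3 : w ^ q = u ^ q * (w / u) ^ q := by
      rw [← Real.mul_rpow hu.le (by positivity)]; congr 1; field_simp
    have h5 : (w / u) ^ 2 ≤ 1 := by
      rw [sq_le_one_iff₀ (by positivity)]; exact (div_le_one hu).2 hwu
    calc u ^ q - w ^ q ≤ u ^ q * (1 - (w / u) ^ 2) := by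
          rw [h3]; nlinarith [Real.rpow_nonneg hu.le q]
      _ ≤ u ^ 2 * (1 - (w / u) ^ 2) := by
          apply mul_le_mul_of_nonneg_right h2; linarith
      _ = _ := by field_simp; ring
  have key2 : ∀ u w : ℝ, 1 ≤ u → 1 ≤ w → |u ^ q - w ^ q| ≤ (u + w) * |u - w| := by
    intro u w hu hw
    rcases le_total w u with h | h
    · rw [abs_of_nonneg (sub_nonneg.2 (Real.rpow_le_rpow (by linarith) h hq)),
        abs_of_nonneg (sub_nonneg.2 h)]
      exact key u w hw h
    · rw [abs_sub_comm, abs_sub_comm u,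
        abs_of_nonneg (sub_nonneg.2 (Real.rpow_le_rpow (by linarith) h hq)),
        abs_of_nonneg (sub_nonneg.2 h), add_comm u]
      exact key w u hu h
  have hd : |max |x| 1 - max |y| 1| ≤ |x - y| := by
    refine (abs_max_sub_max_le_max _ _ _ _).trans ?_
    rw [sub_self, abs_zero, max_eq_left (abs_nonneg _)]
    exact abs_abs_sub_abs_le_abs_sub x y
  have hx : max |x| 1 ≤ 1 + |x| := max_le (by linarith) (by linarith [abs_nonneg x])
  have hy : max |y| 1 ≤ 1 + |y| := max_le (by linarith) (by linarith [abs_nonneg y])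
  refine (key2 _ _ (le_max_right _ _) (le_max_right _ _)).trans ?_
  rw [pow_one, pow_one]
  refine mul_le_mul ?_ hd (abs_nonneg _) (by positivity)
  linarith [abs_nonneg x, abs_nonneg y]

/-! ### Exponential inequality and moment bound -/

namespace SublinearExpectationSpace

variable {Ω : Type*} [MeasurableSpace Ω] {S : SublinearExpectationSpace Ω}

theorem momentFun_mem {Z : Ω → ℝ} (hZ : Z ∈ S.H) {q : ℝ} (hq : 0 ≤ q) (hq2 : q ≤ 2) :
    (fun ω => momentFun q (Z ω)) ∈ S.H :=
  comp_mem_one hZ two_pos 1 fun x y => abs_momentFun_sub_le hq2 x y hq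

theorem exp_clamp_mem {Z : Ω → ℝ} (hZ : Z ∈ S.H) {t δ : ℝ} (ht : 0 ≤ t) (hδ : 0 ≤ δ) (a : ℝ) :
    (fun ω => Real.exp (t * clamp δ (a * Z ω))) ∈ S.H := by
  refine lipschitz_comp_mem hZ (φ := fun x => Real.exp (t * clamp δ (a * x)))
    (C := Real.exp (t * δ) * (t * |a|) + 1) (by positivity) fun x y => ?_
  have hM : ∀ z, t * clamp δ z ≤ t * δ := fun z => mul_le_mul_of_nonneg_left (clamp_le hδ z) ht
  have h1 := abs_exp_sub_exp_le (hM (a * x)) (hM (a * y))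
  have h2 := abs_clamp_sub_clamp_le δ (a * x) (a * y)
  rw [← mul_sub, abs_mul, abs_of_nonneg ht] at h1
  rw [← mul_sub, abs_mul] at h2
  calc _ ≤ _ := h1
    _ ≤ Real.exp (t * δ) * (t * (|a| * |x - y|)) := by gcongr
    _ ≤ _ := by nlinarith [abs_nonneg (x - y)]

/-- The pointwise bounds are integrated. For q > 1 the linear term has upper expectation at most 0;
for q ≤ 1 the pointwise bound contains none. -/
theorem E_exp_clamp_le {Z : Ω → ℝ} (hZ : Z ∈ S.H) {t δ q K a : ℝ} (ht : 0 ≤ t) (hδ : 0 < δ)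
    (hδ1 : δ ≤ 1) (hq : 0 < q) (hq2 : q ≤ 2)
    (hK : S.E (fun ω => momentFun q (Z ω)) ≤ K) (ha : S.E (fun ω => a * Z ω) ≤ 0) :
    S.E (fun ω => Real.exp (t * clamp δ (a * Z ω))) ≤
      ((1 + expConst t δ * |a| ^ q * K : ℝ) : EReal) := by
  have hD := expConst_nonneg ht hδ
  have hM := momentFun_mem hZ hq.le hq2
  have hpw : ∀ ω, expConst t δ * |a * Z ω| ^ q ≤
      expConst t δ * |a| ^ q * momentFun q (Z ω) := fun ω => by
    rw [abs_mul, Real.mul_rpow (abs_nonneg _) (abs_nonneg _), mul_assoc]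
    gcongr
    exact abs_rpow_le_momentFun hq.le _
  have hmom := E_smul_le hM (mul_nonneg hD (Real.rpow_nonneg (abs_nonneg a) q)) hK
  have hmem := smul_mem (expConst t δ * |a| ^ q) hM
  rcases le_or_gt q 1 with h1 | h1
  · refine (S.mono _ (add_mem (S.const_mem 1) hmem) _ (exp_clamp_mem hZ ht hδ.le a)
      fun ω => ?_).trans (E_add_le (S.const_mem 1) hmem (S.const 1).le hmom)
    exact (exp_clamp_le_of_le_one ht hδ hδ1 hq h1 _).trans (add_le_add le_rfl (hpw ω))
  · have hlin : S.E (fun ω => t * (a * Z ω)) ≤ ((t * 0 : ℝ) : EReal) :=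
      E_smul_le (smul_mem a hZ) ht (by exact_mod_cast ha)
    rw [mul_zero] at hlin
    have hmemt := smul_mem t (smul_mem a hZ)
    have := E_add_le (S.const_mem 1) (add_mem hmemt hmem) (S.const 1).le
      (E_add_le hmemt hmem hlin hmom)
    rw [zero_add] at this
    refine (S.mono _ (add_mem (S.const_mem 1) (add_mem hmemt hmem)) _
      (exp_clamp_mem hZ ht hδ.le a) fun ω => ?_).trans this
    have h2 := exp_clamp_le_of_one_lt ht hδ hδ1 h1 hq2 (a * Z ω)
    linarith [hpw ω]

/-- Exponential inequality for sums of independent truncated variables. -/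
theorem prob_lt_sum_clamp_le {X : ℕ → Ω → ℝ} (hX : ∀ i, X i ∈ S.H) (hind : S.IndepSeq X)
    {t δ q K ε : ℝ} (ht : 0 ≤ t) (hδ : 0 < δ) (hδ1 : δ ≤ 1) (hq : 0 < q) (hq2 : q ≤ 2)
    (hK0 : 0 ≤ K) (hK : ∀ i, S.E (fun ω => momentFun q (X i ω)) ≤ K) (a : ℕ → ℝ)
    (ha : ∀ i, 1 ≤ i → S.E (fun ω => a i * X i ω) ≤ 0) (j : ℕ) :
    S.prob {ω | ε < ∑ i ∈ Finset.range (j + 1), clamp δ (a i * X i ω)} ≤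
      Real.exp (-(t * ε)) * Real.exp (t * δ) *
        Real.exp (expConst t δ * K * ∑ i ∈ Finset.range (j + 1), |a i| ^ q) := by
  have hD := expConst_nonneg ht hδ
  have hcm : Measurable (clamp δ) := by unfold clamp; fun_prop
  have hXm := fun i => S.measurable_of_mem _ (hX i)
  have hle : ∀ i y, Real.exp (t * clamp δ (a i * y)) ≤ Real.exp (t * δ) := fun i y =>
    Real.exp_le_exp.2 (mul_le_mul_of_nonneg_left (clamp_le hδ.le _) ht)
  have hmem : ∀ i, (fun ω => Real.exp (t * clamp δ (a i * X i ω))) ∈ S.H := fun i =>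
    exp_clamp_mem (hX i) ht hδ.le _
  have hprod := E_prod_le (S := S) hind (g := fun i y => Real.exp (t * clamp δ (a i * y)))
    (fun i => by fun_prop) (fun i y => (Real.exp_pos _).le) hle hmem
    -- The mean condition starts at index 1, so the factor at index 0 is bounded crudely by exp(t
    -- δ); this is the extra factor in the conclusion.
    (c := fun i => Real.exp ((if i = 0 then t * δ else 0) + expConst t δ * K * |a i| ^ q))
    (fun i => by
      rcases Nat.eq_zero_or_pos i with rfl | hi
      · refine (E_le_of_le_const (hmem 0) (hle 0 <| X 0 ·)).trans ?_
        rw [EReal.coe_le_coe_iff, if_pos rfl]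
        exact Real.exp_le_exp.2 (le_add_of_nonneg_right (by positivity))
      · refine (E_exp_clamp_le (hX i) ht hδ hδ1 hq hq2 (hK i) (ha i hi)).trans ?_
        rw [EReal.coe_le_coe_iff, if_neg hi.ne', zero_add]
        have := Real.add_one_le_exp (expConst t δ * K * |a i| ^ q)
        linarith) j
  have hm : MeasurableSet {ω | ε < ∑ i ∈ Finset.range (j + 1), clamp δ (a i * X i ω)} :=
    measurableSet_lt measurable_const
      (Finset.measurable_sum _ fun i _ => hcm.comp ((hXm i).const_mul _))
  refine prob_le_of_le hm (smul_mem (Real.exp (-(t * ε))) (prod_mem _ hmem))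
    (fun ω => by positivity) (fun ω hω => ?_) ((E_smul_le (prod_mem _ hmem) (by positivity)
      hprod).trans ?_)
  · rw [← Real.exp_sum, ← Finset.mul_sum, ← Real.exp_add]
    apply Real.one_le_exp
    have : ε < ∑ i ∈ Finset.range (j + 1), clamp δ (a i * X i ω) := hω
    nlinarith
  · rw [EReal.coe_le_coe_iff, ← Real.exp_sum, Finset.sum_add_distrib, ← Finset.mul_sum,
      Finset.sum_ite_eq' _ 0 (fun _ => t * δ), if_pos (by simp), Real.exp_add,
      ← mul_assoc]

/-- A finite `V`-series bounds the moments of all variables with the given tails. -/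
theorem exists_moment_bound (hS : S.CountablySubadditive) {v : ℝ → ℝ} {r p : ℝ} (hr : 1 < r)
    (hp : 0 < p) (hsum : ∑' n : ℕ, ENNReal.ofReal (((n : ℝ) + 1) ^ (r - 1)) *
      ENNReal.ofReal (v (((n : ℝ) + 1) ^ p)) < ⊤) {q : ℝ} (hq : 0 < q) (hq2 : q ≤ 2)
    (hpq : p * q ≤ r) :
    ∃ K : ℝ, 0 ≤ K ∧ ∀ Z ∈ S.H, (∀ x, S.prob {ω | x < |Z ω|} = v x) →
      S.E (fun ω => momentFun q (Z ω)) ≤ K := by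
  -- Chosen so that (m+2)^r - (m+1)^r ≤ C (m+1)^(r-1): Bernoulli gives r (m+2)^(r-1), and m + 2 ≤
  -- 2(m+1).
  obtain ⟨C, hC⟩ : ∃ C : ℝ, C = r * 2 ^ (r - 1) := ⟨_, rfl⟩
  have hC0 : 0 < C := by rw [hC]; positivity
  set B : ℝ≥0∞ := 1 + ENNReal.ofReal C * ∑' n : ℕ, ENNReal.ofReal (((n : ℝ) + 1) ^ (r - 1)) *
      ENNReal.ofReal (v (((n : ℝ) + 1) ^ p)) with hB
  have hBt : B ≠ ⊤ := ENNReal.add_ne_top.2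
    ⟨ENNReal.one_ne_top, ENNReal.mul_ne_top ENNReal.ofReal_ne_top hsum.ne⟩
  refine ⟨B.toReal, ENNReal.toReal_nonneg, fun Z hZ hv => ?_⟩
  have hZm := S.measurable_of_mem Z hZ
  set A : ℕ → Set Ω := fun n => {ω | ((n : ℝ) + 1) ^ p < |Z ω|} with hA
  have hAm : ∀ n, MeasurableSet (A n) := fun n =>
    measurableSet_lt measurable_const hZm.abs
  -- Layers dominating the moment function pointwise. Their expectations involve Z only through its
  -- tail, so the resulting bound is the same for every Z with that tail.
  set Y : ℕ → Ω → ℝ := fun n => match n with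
    | 0 => fun _ => 1
    | n + 1 => fun ω => C * ((n : ℝ) + 1) ^ (r - 1) * (A n).indicator (fun _ => (1 : ℝ)) ω with hY
  have hYmem : ∀ n, Y n ∈ S.H := fun n => match n with
    | 0 => S.const_mem 1
    | n + 1 => smul_mem _ (S.indicator_mem _ (hAm n))
  have hYnn : ∀ n ω, 0 ≤ Y n ω := fun n ω => match n with
    | 0 => zero_le_one
    | n + 1 => mul_nonneg (by positivity) (indicator_one_nonneg _ _)
  have key := hS _ (momentFun_mem hZ hq.le hq2) Y hYmem (fun ω => momentFun_nonneg _ _) hYnn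
    (fun ω => ?_)
  · have hEY : ∑' n, (S.E (Y n)).toENNReal = B := by
      rw [tsum_eq_zero_add' ENNReal.summable, hB, ← ENNReal.tsum_mul_left]
      congr 1
      · simp only [hY, S.const 1]
        rw [EReal.toENNReal_of_ne_top (EReal.coe_ne_top _), EReal.toReal_coe, ENNReal.ofReal_one]
      · refine tsum_congr fun n => ?_
        have : S.E (Y (n + 1)) =
            ((C * ((n : ℝ) + 1) ^ (r - 1) * v (((n : ℝ) + 1) ^ p) : ℝ) : EReal) := by
          rw [EReal.coe_mul, ← hv, coe_prob (hAm n)]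
          exact S.pos_homog _ (S.indicator_mem _ (hAm n)) _ (by positivity)
        rw [this, EReal.toENNReal_of_ne_top (EReal.coe_ne_top _), EReal.toReal_coe,
          mul_assoc C, ENNReal.ofReal_mul hC0.le, ENNReal.ofReal_mul (by positivity)]
    rw [hEY] at key
    have h0 := le_E_of_const_le (momentFun_mem hZ hq.le hq2) fun ω => momentFun_nonneg q (Z ω)
    rw [← EReal.coe_toENNReal (x := S.E fun ω => momentFun q (Z ω)) (by exact_mod_cast h0)]
    refine (EReal.coe_ennreal_le_coe_ennreal_iff.2 key).trans_eq ?_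
    rw [← EReal.coe_ennreal_toReal hBt]
  · have hex : ∃ N : ℕ, |Z ω| ≤ ((N : ℝ) + 1) ^ p := by
      refine ⟨⌈|Z ω| ^ p⁻¹⌉₊, ?_⟩
      rw [← Real.rpow_inv_le_iff_of_pos (abs_nonneg _) (by positivity) hp]
      linarith [Nat.le_ceil (|Z ω| ^ p⁻¹)]
    classical
    -- By minimality of N all layers below N are active at ω, and they telescope to at least
    -- (N+1)^r, which dominates (N+1)^(p q).
    set N := Nat.find hex
    have hN := Nat.find_spec hex
    have hlt : ∀ m < N, ω ∈ A m := fun m hm => not_le.1 (Nat.find_min hex hm)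
    have hstep : ∀ m : ℕ, ((m : ℝ) + 1 + 1) ^ r - ((m : ℝ) + 1) ^ r ≤
        C * ((m : ℝ) + 1) ^ (r - 1) := by
      intro m
      have hm : (0 : ℝ) < m + 1 + 1 := by positivity
      have hb := one_add_mul_self_le_rpow_one_add (s := -1 / ((m : ℝ) + 1 + 1))
        (by rw [le_div_iff₀ hm]; linarith [(Nat.cast_nonneg m : (0 : ℝ) ≤ m)]) hr.le
      have e : 1 + -1 / ((m : ℝ) + 1 + 1) = (m + 1) / (m + 1 + 1) := by field_simp; ring
      rw [e, Real.div_rpow (by positivity) hm.le, le_div_iff₀ (by positivity)] at hb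
      have e2 : (1 + r * (-1 / ((m : ℝ) + 1 + 1))) * ((m : ℝ) + 1 + 1) ^ r =
          ((m : ℝ) + 1 + 1) ^ r - r * ((m : ℝ) + 1 + 1) ^ (r - 1) := by
        rw [Real.rpow_sub_one hm.ne']; field_simp; ring
      rw [e2] at hb
      have e3 : ((m : ℝ) + 1 + 1) ^ (r - 1) ≤ 2 ^ (r - 1) * ((m : ℝ) + 1) ^ (r - 1) := by
        rw [← Real.mul_rpow (by norm_num) (by positivity)]
        exact Real.rpow_le_rpow hm.le (by linarith [(Nat.cast_nonneg m : (0 : ℝ) ≤ m)])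
          (by linarith)
      have := mul_le_mul_of_nonneg_left e3 (show 0 ≤ r by linarith)
      rw [hC]
      linarith
    have htel : ∀ N : ℕ, ((N : ℝ) + 1) ^ r ≤
        1 + ∑ m ∈ Finset.range N, C * ((m : ℝ) + 1) ^ (r - 1) := by
      intro N
      induction N with
      | zero => simp
      | succ N ih =>
        rw [Finset.sum_range_succ]
        push_cast
        linarith [hstep N]
    have hW : momentFun q (Z ω) ≤ 1 + ∑ m ∈ Finset.range N, Y (m + 1) ω := by
      have : ∑ m ∈ Finset.range N, Y (m + 1) ω =
          ∑ m ∈ Finset.range N, C * ((m : ℝ) + 1) ^ (r - 1) := by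
        refine Finset.sum_congr rfl fun m hm => ?_
        simp [hY, hlt m (Finset.mem_range.1 hm)]
      rw [this]
      have hN1 : (1 : ℝ) ≤ N + 1 := by linarith [(Nat.cast_nonneg N : (0 : ℝ) ≤ N)]
      refine le_trans ?_ (htel N)
      calc momentFun q (Z ω) ≤ (((N : ℝ) + 1) ^ p) ^ q :=
            Real.rpow_le_rpow (by positivity) (max_le hN (Real.one_le_rpow hN1 hp.le)) hq.le
        _ = ((N : ℝ) + 1) ^ (p * q) := by rw [Real.rpow_mul (by positivity)]
        _ ≤ _ := Real.rpow_le_rpow_of_exponent_le hN1 hpq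
    calc ENNReal.ofReal (momentFun q (Z ω))
        ≤ ENNReal.ofReal (∑ m ∈ Finset.range (N + 1), Y m ω) := by
          refine ENNReal.ofReal_le_ofReal (hW.trans_eq ?_)
          rw [Finset.sum_range_succ', add_comm]
      _ = ∑ m ∈ Finset.range (N + 1), ENNReal.ofReal (Y m ω) :=
          ENNReal.ofReal_sum_of_nonneg fun m _ => hYnn m ω
      _ ≤ _ := ENNReal.sum_le_tsum _

end SublinearExpectationSpace

/-! ### From the double series to the maximal sums -/

/-- The exponent (1-α)s of k is lowered to some θ < 1, so that the power sum has order n^(1-θ) and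
no logarithm arises. If (1-α)s < 1 it is kept, and α s + θ = s > 1; otherwise θ = 1 - α s/2 still
leaves α s + θ > 1. -/
theorem exists_sum_threshold_le {α s : ℝ} (hα0 : 0 < α) (hs : 1 < s) :
    ∃ C η : ℝ, 0 < C ∧ 0 < η ∧ ∀ n : ℕ,
      ∑ k ∈ Finset.range (n + 1), triangleThreshold α (n, k) ^ (-s) ≤ C * ((n : ℝ) + 1) ^ (-η) := by
  obtain ⟨θ, hθ1, hθ2, hθ3⟩ : ∃ θ : ℝ, θ < 1 ∧ θ ≤ (1 - α) * s ∧ 1 < α * s + θ := by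
    have hs0 : 0 < α * s := by positivity
    rcases lt_or_ge ((1 - α) * s) 1 with h | h
    · exact ⟨(1 - α) * s, h, le_rfl, by nlinarith⟩
    · exact ⟨1 - α * s / 2, by linarith, by linarith, by linarith⟩
  obtain ⟨C, hC, hsum⟩ := rpow_sum_le (s := -θ) (by linarith)
  refine ⟨C, α * s + θ - 1, hC, by linarith, fun n => ?_⟩
  have hn : (0 : ℝ) < n + 1 := by positivity
  calc ∑ k ∈ Finset.range (n + 1), triangleThreshold α (n, k) ^ (-s)
      ≤ ∑ k ∈ Finset.range (n + 1), ((n : ℝ) + 1) ^ (-(α * s)) * ((k : ℝ) + 1) ^ (-θ) := by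
        refine Finset.sum_le_sum fun k _ => ?_
        rw [triangleThreshold, Real.mul_rpow (by positivity) (by positivity),
          ← Real.rpow_mul (by positivity), ← Real.rpow_mul (by positivity), mul_neg]
        refine mul_le_mul_of_nonneg_left (Real.rpow_le_rpow_of_exponent_le
          (by linarith [(Nat.cast_nonneg k : (0 : ℝ) ≤ k)]) (by linarith)) (by positivity)
    _ ≤ ((n : ℝ) + 1) ^ (-(α * s)) * (C * ((n : ℝ) + 1) ^ (-θ + 1)) := by
        rw [← Finset.mul_sum]
        have := hsum (n + 1)
        push_cast at this
        gcongr
    _ = _ := by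
        rw [mul_left_comm, ← Real.rpow_add hn]; congr 2; ring

/-- With t = κ log(n+1) this controls the factor t + t² of `expConst`; bounding log by the power η/4
leaves η/2 after squaring. -/
theorem exists_log_growth_le {η κ : ℝ} (hη : 0 < η) (hκ : 0 ≤ κ) :
    ∃ M : ℝ, 0 ≤ M ∧ ∀ n : ℕ, κ * Real.log ((n : ℝ) + 1) + (κ * Real.log ((n : ℝ) + 1)) ^ 2 ≤
      M * ((n : ℝ) + 1) ^ (η / 2) := by
  set c : ℝ := κ * (4 / η) with hc
  refine ⟨c + c ^ 2, by positivity, fun n => ?_⟩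
  have hn1 : (1 : ℝ) ≤ n + 1 := by linarith [(Nat.cast_nonneg n : (0 : ℝ) ≤ n)]
  have hn : (0 : ℝ) < n + 1 := by positivity
  have h := Real.log_le_rpow_div hn.le (show 0 < η / 4 by positivity)
  have hl : 0 ≤ Real.log ((n : ℝ) + 1) := Real.log_nonneg hn1
  have h1 : κ * Real.log ((n : ℝ) + 1) ≤ c * ((n : ℝ) + 1) ^ (η / 4) := by
    calc _ ≤ κ * (((n : ℝ) + 1) ^ (η / 4) / (η / 4)) := by gcongr
      _ = _ := by rw [hc]; field_simp
  have h2 : ((n : ℝ) + 1) ^ (η / 4) ≤ ((n : ℝ) + 1) ^ (η / 2) :=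
    Real.rpow_le_rpow_of_exponent_le hn1 (by linarith)
  have h3 : (((n : ℝ) + 1) ^ (η / 4)) ^ 2 = ((n : ℝ) + 1) ^ (η / 2) := by
    rw [← Real.rpow_natCast, ← Real.rpow_mul hn.le]; congr 1; push_cast; ring
  have hc0 : 0 ≤ c := by positivity
  calc _ ≤ c * ((n : ℝ) + 1) ^ (η / 4) + (c * ((n : ℝ) + 1) ^ (η / 4)) ^ 2 := by gcongr
    _ ≤ c * ((n : ℝ) + 1) ^ (η / 2) + c ^ 2 * ((n : ℝ) + 1) ^ (η / 2) := by
        rw [mul_pow, h3]; gcongr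
    _ = _ := by ring

namespace SublinearExpectationSpace

variable {Ω : Type*} [MeasurableSpace Ω] {S : SublinearExpectationSpace Ω}

theorem triangleSum_eq (X : Ω → ℝ) (r p α c : ℝ) :
    S.triangleSum X r p α c = ∑' n : ℕ, ENNReal.ofReal (((n : ℝ) + 1) ^ (r - 2)) *
      ∑ k ∈ Finset.range (n + 1),
        ENNReal.ofReal (S.prob {ω | c * triangleThreshold α (n, k) ^ p < |X ω|}) := by
  rw [triangleSum, ENNReal.tsum_prod']
  refine tsum_congr fun n => ?_
  rw [tsum_eq_sum (s := Finset.range (n + 1)), Finset.mul_sum]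
  · refine Finset.sum_congr rfl fun k hk => ?_
    rw [triangleWeight, if_pos (Nat.lt_succ_iff.1 (Finset.mem_range.1 hk))]
  · intro k hk
    rw [triangleWeight, if_neg, zero_mul]
    simpa [Nat.lt_succ_iff] using hk

/-- For k ≤ n the threshold is at most n + 1, so each of the n + 1 terms of row n dominates the
diagonal one. This provides the series required by the moment bound. -/
theorem tsum_diagonal_le_triangleSum {X : Ω → ℝ} (hX : X ∈ S.H) {r p α : ℝ} (hp : 0 ≤ p)
    (hα1 : α ≤ 1) :
    ∑' n : ℕ, ENNReal.ofReal (((n : ℝ) + 1) ^ (r - 1)) *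
      ENNReal.ofReal (S.prob {ω | ((n : ℝ) + 1) ^ p < |X ω|}) ≤ S.triangleSum X r p α 1 := by
  have hXm := (S.measurable_of_mem X hX).abs
  rw [triangleSum_eq]
  refine ENNReal.tsum_le_tsum fun n => ?_
  have hn : (0 : ℝ) < n + 1 := by positivity
  have hterm : ∀ k ∈ Finset.range (n + 1),
      ENNReal.ofReal (S.prob {ω | ((n : ℝ) + 1) ^ p < |X ω|}) ≤
        ENNReal.ofReal (S.prob {ω | 1 * triangleThreshold α (n, k) ^ p < |X ω|}) := by
    intro k hk
    have hk' : (k : ℝ) ≤ n := by exact_mod_cast Nat.lt_succ_iff.1 (Finset.mem_range.1 hk)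
    refine ENNReal.ofReal_le_ofReal (prob_lt_antitone hXm ?_)
    rw [one_mul]
    refine Real.rpow_le_rpow (by unfold triangleThreshold; positivity) ?_ hp
    calc ((n : ℝ) + 1) ^ α * ((k : ℝ) + 1) ^ (1 - α)
        ≤ ((n : ℝ) + 1) ^ α * ((n : ℝ) + 1) ^ (1 - α) := by gcongr
      _ = _ := by rw [← Real.rpow_add hn]; simp
  have := Finset.card_nsmul_le_sum _ _ _ hterm
  rw [Finset.card_range, nsmul_eq_mul] at this
  calc _ = ENNReal.ofReal (((n : ℝ) + 1) ^ (r - 2)) * (((n + 1 : ℕ) : ℝ≥0∞) *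
        ENNReal.ofReal (S.prob {ω | ((n : ℝ) + 1) ^ p < |X ω|})) := by
        rw [show r - 1 = (r - 2) + 1 by ring, Real.rpow_add hn, Real.rpow_one,
          ENNReal.ofReal_mul (by positivity), mul_assoc, ← ENNReal.ofReal_natCast (n + 1)]
        push_cast
        rfl
    _ ≤ _ := by gcongr

/-- Polynomial decay of the tails of truncated weighted sums whose `q`-variation decays. -/
theorem exists_prob_clamp_sum_le {X : ℕ → Ω → ℝ} (hX : ∀ i, X i ∈ S.H) (hind : S.IndepSeq X)
    {q K : ℝ} (hq : 0 < q) (hq2 : q ≤ 2) (hK0 : 0 ≤ K)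
    (hK : ∀ i, S.E (fun ω => momentFun q (X i ω)) ≤ K)
    (hmean : ∀ (c : ℝ) (i : ℕ), 1 ≤ i → S.E (fun ω => c * X i ω) ≤ 0)
    {a : ℕ → ℕ → ℝ} {C η : ℝ} (hη : 0 < η)
    (ha : ∀ n, ∑ i ∈ Finset.range (n + 1), |a n i| ^ q ≤ C * ((n : ℝ) + 1) ^ (-η))
    {ε m : ℝ} (hε : 0 < ε) (hm : 0 < m) :
    ∃ δ M : ℝ, 0 < δ ∧ 0 ≤ M ∧ ∀ (n j : ℕ), j ≤ n → ∀ σ : ℝ, |σ| = 1 →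
      S.prob {ω | ε < ∑ i ∈ Finset.range (j + 1), clamp δ (σ * a n i * X i ω)} ≤
        M * ((n : ℝ) + 1) ^ (-m) := by
  -- With t = κ log(n+1) and δ ≤ ε/2, exp(-t(ε - δ)) ≤ (n+1)^(-m). The bound η/(2κ) on δ keeps exp(t
  -- δ) below (n+1)^(η/2); together with t + t² = O(n^(η/2)) this is cancelled by the variation
  -- O(n^(-η)).
  set κ : ℝ := 2 * m / ε with hκ
  have hκ0 : 0 < κ := by positivity
  set δ : ℝ := min (min (ε / 2) 1) (η / (2 * κ)) with hδ
  have hδ0 : 0 < δ := by positivity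
  have hδε : δ ≤ ε / 2 := (min_le_left _ _).trans (min_le_left _ _)
  have hδ1 : δ ≤ 1 := (min_le_left _ _).trans (min_le_right _ _)
  have hδη : κ * δ ≤ η / 2 := by
    have := mul_le_mul_of_nonneg_left (min_le_right (min (ε / 2) 1) (η / (2 * κ))) hκ0.le
    rw [← hδ] at this
    refine this.trans_eq ?_
    field_simp
  have hC0 : 0 ≤ C := by
    have := (Finset.sum_nonneg fun i _ => Real.rpow_nonneg (abs_nonneg (a 0 i)) q).trans (ha 0)
    simpa using this
  obtain ⟨M, hM0, hM⟩ := exists_log_growth_le hη hκ0.le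
  refine ⟨δ, Real.exp (M / δ * K * C), hδ0, (Real.exp_pos _).le, fun n j hj σ hσ => ?_⟩
  have hn1 : (1 : ℝ) ≤ n + 1 := by linarith [(Nat.cast_nonneg n : (0 : ℝ) ≤ n)]
  have hn : (0 : ℝ) < n + 1 := by positivity
  set t : ℝ := κ * Real.log ((n : ℝ) + 1) with ht
  have ht0 : 0 ≤ t := mul_nonneg hκ0.le (Real.log_nonneg hn1)
  have key := prob_lt_sum_clamp_le (S := S) (ε := ε) hX hind ht0 hδ0 hδ1 hq hq2 hK0 hK
    (fun i => σ * a n i) (fun i hi => hmean _ i hi) j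
  refine key.trans ?_
  have hexp : ∀ x : ℝ, Real.exp (t * x) = ((n : ℝ) + 1) ^ (κ * x) := fun x => by
    rw [Real.rpow_def_of_pos hn, ht]; congr 1; ring
  have h1 : Real.exp (-(t * ε)) * Real.exp (t * δ) ≤ ((n : ℝ) + 1) ^ (-m) := by
    rw [← Real.exp_add, show -(t * ε) + t * δ = t * (δ - ε) by ring, hexp]
    refine Real.rpow_le_rpow_of_exponent_le hn1 ?_
    have : κ * (ε / 2) = m := by rw [hκ]; field_simp
    nlinarith
  have hsum : ∑ i ∈ Finset.range (j + 1), |σ * a n i| ^ q ≤ C * ((n : ℝ) + 1) ^ (-η) := by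
    simp only [abs_mul, hσ, one_mul]
    exact (Finset.sum_le_sum_of_subset_of_nonneg
      (Finset.range_mono (Nat.succ_le_succ hj)) fun i _ _ => by positivity).trans (ha n)
  have hD : expConst t δ ≤ M / δ * ((n : ℝ) + 1) ^ η := by
    rw [expConst, hexp, div_mul_eq_mul_div M]
    refine div_le_div_of_nonneg_right ?_ hδ0.le
    calc (t + t ^ 2) * ((n : ℝ) + 1) ^ (κ * δ)
        ≤ (M * ((n : ℝ) + 1) ^ (η / 2)) * ((n : ℝ) + 1) ^ (η / 2) := by
          gcongr
          exact hM n
      _ = _ := by rw [mul_assoc, ← Real.rpow_add hn]; congr 2; ring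
  have h2 : expConst t δ * K * ∑ i ∈ Finset.range (j + 1), |σ * a n i| ^ q ≤ M / δ * K * C := by
    calc _ ≤ (M / δ * ((n : ℝ) + 1) ^ η) * K * (C * ((n : ℝ) + 1) ^ (-η)) := by gcongr
      _ = M / δ * K * C * (((n : ℝ) + 1) ^ η * ((n : ℝ) + 1) ^ (-η)) := by ring
      _ = _ := by rw [← Real.rpow_add hn]; simp
  calc _ ≤ ((n : ℝ) + 1) ^ (-m) * Real.exp (M / δ * K * C) := by gcongr
    _ = _ := mul_comm _ _

/-- The event that the maximum of partial sums exceeds a level. -/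
theorem setOf_lt_sup'_eq {ι : Type*} (c : ℝ) (n : ℕ) (f : ℕ → ι → ℝ) :
    {ω | c < (Finset.range (n + 1)).sup' Finset.nonempty_range_add_one fun j => f j ω} =
      ⋃ j ∈ Finset.range (n + 1), {ω | c < f j ω} := by
  ext ω
  simp [Finset.lt_sup'_iff]

theorem capacity_maxSum_eq {X : ℕ → Ω → ℝ} (hX : ∀ i, X i ∈ S.H) (c : ℝ) (w : ℕ → ℝ) (n : ℕ) :
    S.capacity {ω | c < (Finset.range (n + 1)).sup' Finset.nonempty_range_add_one fun j =>
      |∑ i ∈ Finset.range (j + 1), w i * X i ω|} =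
    ENNReal.ofReal (S.prob (⋃ j ∈ Finset.range (n + 1),
      {ω | c < |∑ i ∈ Finset.range (j + 1), w i * X i ω|})) := by
  rw [setOf_lt_sup'_eq c n fun j ω => |∑ i ∈ Finset.range (j + 1), w i * X i ω|]
  exact capacity_eq (Finset.measurableSet_biUnion _ fun j _ => measurableSet_lt measurable_const
    (Finset.measurable_sum _ fun i _ => (S.measurable_of_mem _ (hX i)).const_mul _).abs)

/-- Truncation of the variables in the event that some weighted partial sum is large. -/
theorem prob_maxSum_le {X : ℕ → Ω → ℝ} (hX : ∀ i, X i ∈ S.H) {ε δ N B : ℝ} (hN : 0 < N)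
    {w : ℕ → ℝ} (n : ℕ)
    (hB : ∀ j, j ≤ n → ∀ σ : ℝ, |σ| = 1 →
      S.prob {ω | ε < ∑ i ∈ Finset.range (j + 1), clamp δ (σ * (w i / N) * X i ω)} ≤ B) :
    S.prob (⋃ j ∈ Finset.range (n + 1),
      {ω | ε * N < |∑ i ∈ Finset.range (j + 1), w i * X i ω|}) ≤
      ∑ i ∈ Finset.range (n + 1), S.prob {ω | δ < |w i / N * X i ω|} +
        2 * ((n : ℝ) + 1) * B := by
  have hXm := fun i => S.measurable_of_mem _ (hX i)
  have hcm : Measurable (clamp δ) := by unfold clamp; fun_prop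
  have mE : ∀ i, MeasurableSet {ω | δ < |w i / N * X i ω|} := fun i =>
    measurableSet_lt measurable_const ((hXm i).const_mul _).abs
  have mF : ∀ (σ : ℝ) (j : ℕ),
      MeasurableSet {ω | ε < ∑ i ∈ Finset.range (j + 1), clamp δ (σ * (w i / N) * X i ω)} :=
    fun σ j => measurableSet_lt measurable_const
      (Finset.measurable_sum _ fun i _ => hcm.comp ((hXm i).const_mul _))
  have mUE := Finset.measurableSet_biUnion (Finset.range (n + 1)) fun i _ => mE i
  have mUF := fun σ => Finset.measurableSet_biUnion (Finset.range (n + 1)) fun j _ => mF σ j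
  have mS := Finset.measurableSet_biUnion (Finset.range (n + 1)) fun j _ =>
    measurableSet_lt (measurable_const (a := ε * N)) (Finset.measurable_sum
      (Finset.range (j + 1)) fun i _ => (hXm i).const_mul (w i)).abs
  have hsub : (⋃ j ∈ Finset.range (n + 1),
      {ω | ε * N < |∑ i ∈ Finset.range (j + 1), w i * X i ω|}) ⊆
      (⋃ i ∈ Finset.range (n + 1), {ω | δ < |w i / N * X i ω|}) ∪
      ((⋃ j ∈ Finset.range (n + 1),
          {ω | ε < ∑ i ∈ Finset.range (j + 1), clamp δ (1 * (w i / N) * X i ω)}) ∪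
        ⋃ j ∈ Finset.range (n + 1),
          {ω | ε < ∑ i ∈ Finset.range (j + 1), clamp δ (-1 * (w i / N) * X i ω)}) := by
    intro ω hω
    obtain ⟨j, hj, hω⟩ := Set.mem_iUnion₂.1 hω
    by_cases hE : ω ∈ ⋃ i ∈ Finset.range (n + 1), {ω | δ < |w i / N * X i ω|}
    · exact Or.inl hE
    right
    have hsmall : ∀ i ∈ Finset.range (j + 1), |w i / N * X i ω| ≤ δ := fun i hi => by
      by_contra hlt
      refine hE (Set.mem_iUnion₂.2 ⟨i, ?_, not_le.1 hlt⟩)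
      rw [Finset.mem_range] at hi hj ⊢
      omega
    have hcl : ∀ σ : ℝ, |σ| = 1 →
        ∑ i ∈ Finset.range (j + 1), clamp δ (σ * (w i / N) * X i ω) =
          σ * ((∑ i ∈ Finset.range (j + 1), w i * X i ω) / N) := by
      intro σ hσ
      rw [Finset.sum_div, Finset.mul_sum]
      refine Finset.sum_congr rfl fun i hi => ?_
      rw [clamp_of_abs_le]
      · ring
      · rw [mul_assoc, abs_mul, hσ, one_mul]; exact hsmall i hi
    have habs : ε < |(∑ i ∈ Finset.range (j + 1), w i * X i ω) / N| := by
      rw [abs_div, abs_of_pos hN, lt_div_iff₀ hN]; exact hω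
    rcases lt_abs.1 habs with h | h
    · refine Or.inl (Set.mem_iUnion₂.2 ⟨j, hj, ?_⟩)
      rw [Set.mem_ofPred_eq, hcl 1 (by simp), one_mul]
      exact h
    · refine Or.inr (Set.mem_iUnion₂.2 ⟨j, hj, ?_⟩)
      rw [Set.mem_ofPred_eq, hcl (-1) (by simp), neg_one_mul]
      exact h
  have hF : ∀ σ : ℝ, |σ| = 1 → S.prob (⋃ j ∈ Finset.range (n + 1),
      {ω | ε < ∑ i ∈ Finset.range (j + 1), clamp δ (σ * (w i / N) * X i ω)}) ≤
      ((n : ℝ) + 1) * B := by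
    intro σ hσ
    refine (prob_biUnion_le _ (mF σ) (mUF σ) le_rfl).trans ?_
    refine (Finset.sum_le_card_nsmul _ _ B fun j hj =>
      hB j (Nat.lt_succ_iff.1 (Finset.mem_range.1 hj)) σ hσ).trans_eq ?_
    simp
  have h1 := prob_union_le (S := S) mUE ((mUF 1).union (mUF (-1))) mS hsub
  have h2 := prob_union_le (S := S) (mUF 1) (mUF (-1)) ((mUF 1).union (mUF (-1))) le_rfl
  have h3 := prob_biUnion_le (S := S) _ mE mUE le_rfl
  have h4 := hF 1 (by simp)
  have h5 := hF (-1) (by simp)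
  linarith

theorem tsum_capacity_lt_top (hS : S.CountablySubadditive) {X : Ω → ℝ} (hX : X ∈ S.H)
    {Xs : ℕ → Ω → ℝ} (hXs : ∀ n, Xs n ∈ S.H) (hindep : S.IndepSeq Xs)
    (hident : ∀ n, S.IdentDistr (Xs n) X)
    (hmean : ∀ i : ℕ, 1 ≤ i → S.E (Xs i) = 0 ∧ -S.E (fun ω => -Xs i ω) = 0)
    {r p α : ℝ} (hr : 1 < r) (hp : 1 / 2 < p) (hα0 : 0 < α) (hα1 : α ≤ 1)
    (hfin : ∀ c, 0 < c → S.triangleSum X r p α c < ⊤) {ε : ℝ} (hε : 0 < ε) :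
    ∑' n : ℕ, ENNReal.ofReal (((n + 1 : ℕ) : ℝ) ^ (r - 2)) *
      S.capacity {ω | ε * cesaroNumber α (n + 1) ^ p <
        (Finset.range (n + 1)).sup' Finset.nonempty_range_add_one (fun j =>
          |∑ i ∈ Finset.range (j + 1), cesaroNumber (α - 1) (n + 1 - i) ^ p * Xs i ω|)} < ⊤ := by
  have hp0 : 0 < p := by linarith
  have hdist : ∀ i x, S.prob {ω | x < |Xs i ω|} = S.prob {ω | x < |X ω|} := fun i x =>
    prob_preimage_eq (hXs i) hX (hident i) (B := {y | x < |y|})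
      (measurableSet_lt measurable_const measurable_id.abs)
  -- Then p q = min(r, 2p): at most r, as the moment bound requires, and above 1 since r > 1 and p >
  -- 1/2, as the decay of the variation requires.
  set q : ℝ := min (r / p) 2 with hq
  have hq0 : 0 < q := by positivity
  have hq2 : q ≤ 2 := min_le_right _ _
  have hpq : p * q = min r (2 * p) := by
    rw [hq, mul_min_of_nonneg _ _ hp0.le]; congr 1 <;> field_simp
  obtain ⟨K, hK0, hK⟩ := exists_moment_bound hS (v := fun x => S.prob {ω | x < |X ω|}) hr hp0
    ((tsum_diagonal_le_triangleSum hX hp0.le hα1).trans_lt (hfin 1 one_pos)) hq0 hq2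
    (hpq.trans_le (min_le_left _ _))
  have hmean' : ∀ (c : ℝ) (i : ℕ), 1 ≤ i → S.E (fun ω => c * Xs i ω) ≤ 0 := by
    intro c i hi
    obtain ⟨h1, h2⟩ := hmean i hi
    rw [EReal.neg_eq_zero_iff] at h2
    rcases le_total 0 c with hc | hc
    · rw [S.pos_homog _ (hXs i) c hc, h1, mul_zero]
    · have := S.pos_homog _ (neg_mem (hXs i)) (-c) (by linarith)
      rw [h2, mul_zero] at this
      simpa using this.le
  obtain ⟨_, C, _, hC, hbounds⟩ := exists_cesaro_quotient_bounds hp0 hα0 hα1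
  set w : ℕ → ℕ → ℝ := fun n i => cesaroNumber (α - 1) (n + 1 - i) ^ p with hw
  set N : ℕ → ℝ := fun n => cesaroNumber α (n + 1) ^ p with hN
  have hN0 : ∀ n, 0 < N n := fun n => (hbounds n 0).1
  -- The weight index n + 1 - i is at least 1, so the conventional value at index 0 is never used;
  -- the substitution k = n - i matches weights with thresholds.
  have hsub : ∀ n i, i ∈ Finset.range (n + 1) → n + 1 - i = n - i + 1 := fun n i hi => by
    rw [Finset.mem_range] at hi; omega
  have hthr : ∀ i, 0 < triangleThreshold α i := fun i =>
    zero_lt_one.trans_le (one_le_triangleThreshold hα0.le hα1 i)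
  have hw0 : ∀ n i, i ∈ Finset.range (n + 1) → 0 < w n i := fun n i hi => by
    simp only [hw, hsub n i hi]; exact (hbounds n (n - i)).2.2.1
  have hwN : ∀ n i, i ∈ Finset.range (n + 1) →
      C * triangleThreshold α (n, n - i) ^ p * w n i ≤ N n := fun n i hi => by
    simp only [hw, hsub n i hi]; exact (hbounds n (n - i)).2.2.2
  obtain ⟨D, η, hD, hη, hthrsum⟩ := exists_sum_threshold_le hα0
    (show 1 < p * q by rw [hpq]; exact lt_min hr (by linarith))
  have hvar : ∀ n, ∑ i ∈ Finset.range (n + 1), |w n i / N n| ^ q ≤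
      (C ^ (-q) * D) * ((n : ℝ) + 1) ^ (-η) := by
    intro n
    have : ∀ i ∈ Finset.range (n + 1), |w n i / N n| ^ q ≤
        C ^ (-q) * triangleThreshold α (n, n - i) ^ (-(p * q)) := by
      intro i hi
      have h1 := hwN n i hi
      have h2 := hthr (n, n - i)
      have h3 := hw0 n i hi
      rw [abs_of_pos (div_pos h3 (hN0 n))]
      calc (w n i / N n) ^ q ≤ ((C * triangleThreshold α (n, n - i) ^ p)⁻¹) ^ q := by
            refine Real.rpow_le_rpow (div_pos h3 (hN0 n)).le ?_ hq0.le
            rw [div_le_iff₀ (hN0 n), ← div_eq_inv_mul, le_div_iff₀ (by positivity)]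
            linarith
        _ = _ := by
            rw [Real.inv_rpow (by positivity), Real.mul_rpow hC.le (by positivity),
              ← Real.rpow_mul h2.le, mul_inv, Real.rpow_neg hC.le, Real.rpow_neg h2.le]
    refine (Finset.sum_le_sum this).trans ?_
    rw [← Finset.mul_sum, mul_assoc]
    have hrefl := Finset.sum_range_reflect
      (fun k => triangleThreshold α (n, k) ^ (-(p * q))) (n + 1)
    simp only [Nat.add_sub_cancel] at hrefl
    rw [hrefl]
    gcongr
    exact hthrsum n
  -- Decay of order r + 1 is what the union bound needs: n^(r-2) · n · n^(-(r+1)) = n^(-2) is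
  -- summable.
  obtain ⟨δ, M, hδ, hM, htail⟩ := exists_prob_clamp_sum_le (S := S) hXs hindep hq0 hq2 hK0
    (fun i => hK _ (hXs i) (hdist i)) hmean' hη hvar hε (show 0 < r + 1 by linarith)
  have hterm : ∀ n : ℕ, ENNReal.ofReal (((n + 1 : ℕ) : ℝ) ^ (r - 2)) *
      S.capacity {ω | ε * cesaroNumber α (n + 1) ^ p <
        (Finset.range (n + 1)).sup' Finset.nonempty_range_add_one (fun j =>
          |∑ i ∈ Finset.range (j + 1), cesaroNumber (α - 1) (n + 1 - i) ^ p * Xs i ω|)} ≤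
      ENNReal.ofReal (((n : ℝ) + 1) ^ (r - 2)) * ∑ k ∈ Finset.range (n + 1),
        ENNReal.ofReal (S.prob {ω | δ * C * triangleThreshold α (n, k) ^ p < |X ω|}) +
      ENNReal.ofReal (2 * M * ((n : ℝ) + 1) ^ (-2 : ℝ)) := by
    intro n
    have hn : (0 : ℝ) < n + 1 := by positivity
    rw [capacity_maxSum_eq hXs]
    have hmax := prob_maxSum_le (S := S) hXs (ε := ε) (hN0 n) n (htail n)
    have hE : ∑ i ∈ Finset.range (n + 1), S.prob {ω | δ < |w n i / N n * Xs i ω|} ≤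
        ∑ k ∈ Finset.range (n + 1),
          S.prob {ω | δ * C * triangleThreshold α (n, k) ^ p < |X ω|} := by
      have hrefl := Finset.sum_range_reflect
        (fun k => S.prob {ω | δ * C * triangleThreshold α (n, k) ^ p < |X ω|}) (n + 1)
      simp only [Nat.add_sub_cancel] at hrefl
      rw [← hrefl]
      refine Finset.sum_le_sum fun i hi => ?_
      rw [← hdist i]
      have hXm := S.measurable_of_mem _ (hXs i)
      refine prob_mono (measurableSet_lt measurable_const (hXm.const_mul _).abs)
        (measurableSet_lt measurable_const hXm.abs) fun ω hω => ?_
      have hω' : δ < |w n i / N n * Xs i ω| := hω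
      rw [abs_mul, abs_of_pos (div_pos (hw0 n i hi) (hN0 n)), div_mul_eq_mul_div,
        lt_div_iff₀ (hN0 n)] at hω'
      have h1 := mul_le_mul_of_nonneg_left (hwN n i hi) hδ.le
      refine lt_of_mul_lt_mul_left ?_ (hw0 n i hi).le
      linarith
    push_cast
    calc ENNReal.ofReal (((n : ℝ) + 1) ^ (r - 2)) * ENNReal.ofReal _
        ≤ ENNReal.ofReal (((n : ℝ) + 1) ^ (r - 2)) * ENNReal.ofReal
          ((∑ k ∈ Finset.range (n + 1),
            S.prob {ω | δ * C * triangleThreshold α (n, k) ^ p < |X ω|}) +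
            2 * ((n : ℝ) + 1) * (M * ((n : ℝ) + 1) ^ (-(r + 1)))) := by
          gcongr
          exact hmax.trans (add_le_add hE le_rfl)
      _ = _ := by
          have hpn : ∀ k, 0 ≤ S.prob {ω | δ * C * triangleThreshold α (n, k) ^ p < |X ω|} :=
            fun k => prob_nonneg (measurableSet_lt measurable_const
              (S.measurable_of_mem _ hX).abs)
          rw [ENNReal.ofReal_add (Finset.sum_nonneg fun k _ => hpn k) (by positivity), mul_add,
            ENNReal.ofReal_sum_of_nonneg fun k _ => hpn k,
            ← ENNReal.ofReal_mul (q := 2 * ((n : ℝ) + 1) * (M * ((n : ℝ) + 1) ^ (-(r + 1))))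
              (by positivity)]
          congr 2
          rw [show (-2 : ℝ) = (r - 2) + 1 + (-(r + 1)) by ring, Real.rpow_add hn,
            Real.rpow_add hn, Real.rpow_one]
          ring
  refine (ENNReal.tsum_le_tsum hterm).trans_lt ?_
  rw [ENNReal.tsum_add, ← triangleSum_eq]
  refine ENNReal.add_lt_top.2 ⟨hfin _ (by positivity), ?_⟩
  have hsumm : Summable fun n : ℕ => 2 * M * ((n : ℝ) + 1) ^ (-2 : ℝ) := by
    refine Summable.mul_left _ ?_
    have := (summable_nat_add_iff 1).2 (Real.summable_nat_rpow.2 (show (-2 : ℝ) < -1 by norm_num))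
    simpa using this
  exact hsumm.tsum_ofReal_lt_top

end SublinearExpectationSpace

/-! ### From the maximal sums back to the double series -/

/-- If `∑ (n+1)^(r-2) min(s n, 1)` converges and `s m ≤ 2 s n` for `n ≤ m ≤ 2n+1`, then
`∑ (n+1)^(r-2) s n` converges. -/
theorem tsum_lt_top_of_tsum_min_lt_top {r : ℝ} (hr : 1 < r) {s : ℕ → ℝ} (hs0 : ∀ n, 0 ≤ s n)
    (hs : ∀ n m, n ≤ m → m ≤ 2 * n + 1 → s m ≤ 2 * s n)
    (h : ∑' n : ℕ, ENNReal.ofReal (((n : ℝ) + 1) ^ (r - 2) * min (s n) 1) < ⊤) :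
    ∑' n : ℕ, ENNReal.ofReal (((n : ℝ) + 1) ^ (r - 2) * s n) < ⊤ := by
  have hnn : ∀ n : ℕ, 0 ≤ ((n : ℝ) + 1) ^ (r - 2) * min (s n) 1 := fun n =>
    mul_nonneg (by positivity) (le_min (hs0 n) zero_le_one)
  have hsumm : Summable fun n : ℕ => ((n : ℝ) + 1) ^ (r - 2) * min (s n) 1 := by
    have := ENNReal.summable_toReal h.ne
    simpa only [ENNReal.toReal_ofReal (hnn _)] using this
  obtain ⟨κ, hκ, hpow⟩ := exists_le_rpow_of_half_le (r - 2)
  -- If s m ≥ 1, doubling gives s n ≥ 1/2 for all n between m/2 and m. That block of the convergent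
  -- series then contributes at least (κ/4)(m+1)^(r-1) ≥ κ/4, which the Cauchy criterion excludes
  -- for large m.
  have hev : ∀ᶠ m in Filter.atTop, s m < 1 := by
    have htail := hsumm.hasSum.tendsto_sum_nat
    have hhalf : Filter.Tendsto (fun m : ℕ => m / 2) Filter.atTop Filter.atTop :=
      Filter.tendsto_atTop.2 fun b => Filter.eventually_atTop.2 ⟨2 * b, fun m hm => by omega⟩
    have hdiff := (htail.comp (Filter.tendsto_add_atTop_nat 1)).sub (htail.comp hhalf)
    rw [sub_self] at hdiff
    filter_upwards [hdiff.eventually (gt_mem_nhds (show 0 < κ / 4 by positivity))] with m hm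
    by_contra hsm
    rw [not_lt] at hsm
    have hm0 : (0 : ℝ) < m + 1 := by positivity
    have hterm : ∀ n ∈ Finset.Ico (m / 2) (m + 1), κ * ((m : ℝ) + 1) ^ (r - 2) / 2 ≤
        ((n : ℝ) + 1) ^ (r - 2) * min (s n) 1 := by
      intro n hn
      obtain ⟨h1, h2⟩ := Finset.mem_Ico.1 hn
      have h3 : ((m : ℝ) + 1) / 2 ≤ n + 1 := by
        have : (m : ℝ) ≤ 2 * n + 1 := by exact_mod_cast (by omega : m ≤ 2 * n + 1)
        linarith
      have h4 : (n : ℝ) + 1 ≤ m + 1 := by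
        have : (n : ℝ) ≤ m := by exact_mod_cast Nat.lt_succ_iff.1 h2
        linarith
      have h5 := hpow _ _ hm0 h3 h4
      have h6 : 1 / 2 ≤ min (s n) 1 :=
        le_min (by linarith [hs n m (by omega) (by omega)]) (by norm_num)
      calc _ = κ * ((m : ℝ) + 1) ^ (r - 2) * (1 / 2) := by ring
        _ ≤ _ := by gcongr
    have hsum := Finset.card_nsmul_le_sum _ _ _ hterm
    rw [Nat.card_Ico, nsmul_eq_mul, Finset.sum_Ico_eq_sub _ (by omega)] at hsum
    have hcard : ((m : ℝ) + 1) / 2 ≤ ((m + 1 - m / 2 : ℕ) : ℝ) := by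
      have : ((m + 1 : ℕ) : ℝ) ≤ ((2 * (m + 1 - m / 2) : ℕ) : ℝ) := by
        exact_mod_cast (by omega : m + 1 ≤ 2 * (m + 1 - m / 2))
      push_cast at this
      linarith
    have hr1 : (1 : ℝ) ≤ ((m : ℝ) + 1) ^ (r - 1) :=
      Real.one_le_rpow (by linarith [(Nat.cast_nonneg m : (0 : ℝ) ≤ m)]) (by linarith)
    have : κ / 4 ≤ ((m + 1 - m / 2 : ℕ) : ℝ) * (κ * ((m : ℝ) + 1) ^ (r - 2) / 2) := by
      calc κ / 4 = κ / 4 * 1 := by ring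
        _ ≤ κ / 4 * ((m : ℝ) + 1) ^ (r - 1) := by gcongr
        _ = ((m : ℝ) + 1) / 2 * (κ * ((m : ℝ) + 1) ^ (r - 2) / 2) := by
            rw [show r - 1 = (r - 2) + 1 by ring, Real.rpow_add hm0, Real.rpow_one]; ring
        _ ≤ _ := by gcongr
    simp only [Function.comp_apply] at hm
    linarith
  have hsumm2 : Summable fun n : ℕ => ((n : ℝ) + 1) ^ (r - 2) * s n := by
    refine (summable_congr_atTop ?_).1 hsumm
    filter_upwards [hev] with n hn
    rw [min_eq_left hn.le]
  exact hsumm2.tsum_ofReal_lt_top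

/-- The elementary inequality `1 - e^(-s) ≥ min(s, 1) / 2`. -/
theorem min_div_two_le_one_sub_exp_neg {s : ℝ} (hs : 0 ≤ s) :
    min s 1 / 2 ≤ 1 - Real.exp (-s) := by
  have hm : 0 ≤ min s 1 := le_min hs zero_le_one
  have h1 : Real.exp (-s) ≤ Real.exp (-min s 1) :=
    Real.exp_le_exp.2 (neg_le_neg (min_le_left _ _))
  have h2 : Real.exp (-min s 1) ≤ 1 / (1 + min s 1) := by
    rw [Real.exp_neg, one_div]
    exact inv_anti₀ (by linarith) (by linarith [Real.add_one_le_exp (min s 1)])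
  have h3 : 1 / (1 + min s 1) ≤ 1 - min s 1 / 2 := by
    rw [div_le_iff₀ (by linarith)]
    nlinarith [min_le_right s 1]
  linarith

namespace SublinearExpectationSpace

variable {Ω : Type*} [MeasurableSpace Ω] {S : SublinearExpectationSpace Ω}

/-- The quantitative second Borel–Cantelli argument: the exact product formula for lower
probabilities combined with 1 - x ≤ e^(-x). -/
theorem min_sum_prob_le {X : ℕ → Ω → ℝ} (hX : ∀ i, X i ∈ S.H) (hind : S.IndepSeq X)
    {B : ℕ → Set ℝ} (hB : ∀ i, MeasurableSet (B i)) (n : ℕ) :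
    min (∑ i ∈ Finset.range (n + 1), S.prob (X i ⁻¹' B i)) 1 / 2 ≤
      S.prob (⋃ i ∈ Finset.range (n + 1), X i ⁻¹' B i) := by
  have hm : ∀ i, MeasurableSet (X i ⁻¹' B i) := fun i => S.measurable_of_mem _ (hX i) (hB i)
  have h1 := one_sub_prob_biUnion (S := S) hX hind hB n
  have h2 : ∏ i ∈ Finset.range (n + 1), (1 - S.prob (X i ⁻¹' B i)) ≤
      Real.exp (-∑ i ∈ Finset.range (n + 1), S.prob (X i ⁻¹' B i)) := by
    rw [← Finset.sum_neg_distrib, Real.exp_sum]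
    refine Finset.prod_le_prod (fun i _ => by linarith [prob_le_one (S := S) (hm i)]) fun i _ => ?_
    exact Real.one_sub_le_exp_neg _
  have h3 := min_div_two_le_one_sub_exp_neg
    (Finset.sum_nonneg fun i (_ : i ∈ Finset.range (n + 1)) => prob_nonneg (S := S) (hm i))
  linarith

/-- Each term is the difference of two consecutive partial sums, the empty sum preceding the first;
if all are at most c in absolute value, no term exceeds 2c. -/
theorem prob_exists_term_le_prob_maxSum {X : ℕ → Ω → ℝ} (hX : ∀ i, X i ∈ S.H) (c : ℝ)
    (hc : 0 ≤ c) (w : ℕ → ℝ) (n : ℕ) :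
    S.prob (⋃ i ∈ Finset.range (n + 1), {ω | 2 * c < |w i * X i ω|}) ≤
      S.prob (⋃ j ∈ Finset.range (n + 1), {ω | c < |∑ i ∈ Finset.range (j + 1), w i * X i ω|}) := by
  have hXm := fun i => S.measurable_of_mem _ (hX i)
  refine prob_mono (Finset.measurableSet_biUnion _ fun i _ =>
      measurableSet_lt measurable_const ((hXm i).const_mul _).abs)
    (Finset.measurableSet_biUnion _ fun j _ => measurableSet_lt measurable_const
      (Finset.measurable_sum _ fun i _ => (hXm i).const_mul _).abs) fun ω hω => ?_
  obtain ⟨i, hi, hω⟩ := Set.mem_iUnion₂.1 hω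
  by_contra hcon
  have hle : ∀ j ∈ Finset.range (n + 1), |∑ i ∈ Finset.range (j + 1), w i * X i ω| ≤ c :=
    fun j hj => by
      by_contra hlt
      exact hcon (Set.mem_iUnion₂.2 ⟨j, hj, not_le.1 hlt⟩)
  have hω' : 2 * c < |w i * X i ω| := hω
  have h1 := hle i hi
  have h2 : |∑ k ∈ Finset.range i, w k * X k ω| ≤ c := by
    rcases Nat.eq_zero_or_pos i with rfl | hpos
    · simpa using hc
    · have := hle (i - 1) (by rw [Finset.mem_range] at hi ⊢; omega)
      rwa [Nat.sub_add_cancel hpos] at this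
  rw [Finset.sum_range_succ] at h1
  have h3 := abs_sub (∑ k ∈ Finset.range i, w k * X k ω + w i * X i ω)
    (∑ k ∈ Finset.range i, w k * X k ω)
  rw [add_sub_cancel_left] at h3
  linarith

/-- Thresholds increase in both indices, so terms 2k and 2k + 1 of row m are each at most term k of
row n. -/
theorem sum_prob_threshold_le {X : Ω → ℝ} (hX : X ∈ S.H) {p α c : ℝ} (hp : 0 ≤ p) (hα0 : 0 ≤ α)
    (hα1 : α ≤ 1) (hc : 0 ≤ c) {n m : ℕ} (hnm : n ≤ m) (hm : m ≤ 2 * n + 1) :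
    ∑ k ∈ Finset.range (m + 1), S.prob {ω | c * triangleThreshold α (m, k) ^ p < |X ω|} ≤
      2 * ∑ k ∈ Finset.range (n + 1),
        S.prob {ω | c * triangleThreshold α (n, k) ^ p < |X ω|} := by
  have hXm := (S.measurable_of_mem X hX).abs
  have hthr : ∀ i, 0 ≤ triangleThreshold α i := fun i =>
    zero_le_one.trans (one_le_triangleThreshold hα0 hα1 i)
  have hmono : ∀ k l : ℕ, l ≤ k → S.prob {ω | c * triangleThreshold α (m, k) ^ p < |X ω|} ≤
      S.prob {ω | c * triangleThreshold α (n, l) ^ p < |X ω|} := fun k l hlk => by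
    refine prob_lt_antitone hXm (mul_le_mul_of_nonneg_left
      (Real.rpow_le_rpow (hthr _) ?_ hp) hc)
    have h1 : (n : ℝ) ≤ m := by exact_mod_cast hnm
    have h2 : (l : ℝ) ≤ k := by exact_mod_cast hlk
    unfold triangleThreshold
    have h3 : 0 ≤ 1 - α := by linarith
    gcongr
  have hdouble : ∀ N : ℕ, ∑ k ∈ Finset.range (2 * N),
      S.prob {ω | c * triangleThreshold α (m, k) ^ p < |X ω|} ≤
      2 * ∑ k ∈ Finset.range N, S.prob {ω | c * triangleThreshold α (n, k) ^ p < |X ω|} := by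
    intro N
    induction N with
    | zero => simp
    | succ N ih =>
      rw [show 2 * (N + 1) = 2 * N + 1 + 1 by ring, Finset.sum_range_succ, Finset.sum_range_succ,
        Finset.sum_range_succ]
      linarith [hmono (2 * N) N (by omega), hmono (2 * N + 1) N (by omega)]
  refine le_trans ?_ (hdouble (n + 1))
  exact Finset.sum_le_sum_of_subset_of_nonneg (Finset.range_mono (by omega))
    fun k _ _ => prob_nonneg (measurableSet_lt measurable_const hXm)

theorem exists_triangleSum_lt_top {X : Ω → ℝ} (hX : X ∈ S.H)
    {Xs : ℕ → Ω → ℝ} (hXs : ∀ n, Xs n ∈ S.H) (hindep : S.IndepSeq Xs)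
    (hident : ∀ n, S.IdentDistr (Xs n) X)
    {r p α : ℝ} (hr : 1 < r) (hp : 0 < p) (hα0 : 0 < α) (hα1 : α ≤ 1)
    (hfin : ∑' n : ℕ, ENNReal.ofReal (((n + 1 : ℕ) : ℝ) ^ (r - 2)) *
      S.capacity {ω | 1 * cesaroNumber α (n + 1) ^ p <
        (Finset.range (n + 1)).sup' Finset.nonempty_range_add_one (fun j =>
          |∑ i ∈ Finset.range (j + 1),
            cesaroNumber (α - 1) (n + 1 - i) ^ p * Xs i ω|)} < ⊤) :
    ∃ c, 0 < c ∧ S.triangleSum X r p α c < ⊤ := by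
  have hdist : ∀ i x, S.prob {ω | x < |Xs i ω|} = S.prob {ω | x < |X ω|} := fun i x =>
    prob_preimage_eq (hXs i) hX (hident i) (B := {y | x < |y|})
      (measurableSet_lt measurable_const measurable_id.abs)
  obtain ⟨C, _, hC, _, hbounds⟩ := exists_cesaro_quotient_bounds hp hα0 hα1
  -- The 2 is lost between partial sums and single terms, and C in comparing the weights with the
  -- thresholds.
  refine ⟨2 * C, by positivity, ?_⟩
  have hXm := (S.measurable_of_mem X hX).abs
  set s : ℕ → ℝ := fun n => ∑ k ∈ Finset.range (n + 1),
    S.prob {ω | 2 * C * triangleThreshold α (n, k) ^ p < |X ω|} with hs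
  have hpn : ∀ x, 0 ≤ S.prob {ω | x < |X ω|} := fun x =>
    prob_nonneg (measurableSet_lt measurable_const hXm)
  have hs0 : ∀ n, 0 ≤ s n := fun n => Finset.sum_nonneg fun k _ => hpn _
  have htri : S.triangleSum X r p α (2 * C) =
      ∑' n : ℕ, ENNReal.ofReal (((n : ℝ) + 1) ^ (r - 2) * s n) := by
    rw [triangleSum_eq]
    refine tsum_congr fun n => ?_
    rw [ENNReal.ofReal_mul (by positivity), ENNReal.ofReal_sum_of_nonneg fun k _ => hpn _]
  rw [htri]
  refine tsum_lt_top_of_tsum_min_lt_top hr hs0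
    (fun n m h1 h2 => sum_prob_threshold_le hX hp.le hα0.le hα1 (by positivity) h1 h2) ?_
  have hmin : ∀ n, min (s n) 1 ≤ 2 * S.prob (⋃ j ∈ Finset.range (n + 1),
      {ω | 1 * cesaroNumber α (n + 1) ^ p < |∑ i ∈ Finset.range (j + 1),
        cesaroNumber (α - 1) (n + 1 - i) ^ p * Xs i ω|}) := by
    intro n
    have h1 := prob_exists_term_le_prob_maxSum (S := S) hXs (1 * cesaroNumber α (n + 1) ^ p)
      (by linarith [(hbounds n 0).1]) (fun i => cesaroNumber (α - 1) (n + 1 - i) ^ p) n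
    set B : ℕ → Set ℝ := fun i => {x | 2 * (1 * cesaroNumber α (n + 1) ^ p) <
      |cesaroNumber (α - 1) (n + 1 - i) ^ p * x|} with hB
    have hBm : ∀ i, MeasurableSet (B i) := fun i =>
      measurableSet_lt measurable_const (measurable_id.const_mul _).abs
    have h2 := min_sum_prob_le (S := S) hXs hindep hBm n
    have h3 : s n ≤ ∑ i ∈ Finset.range (n + 1), S.prob (Xs i ⁻¹' B i) := by
      have hrefl := Finset.sum_range_reflect
        (fun k => S.prob {ω | 2 * C * triangleThreshold α (n, k) ^ p < |X ω|}) (n + 1)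
      simp only [Nat.add_sub_cancel] at hrefl
      rw [hs]
      dsimp only
      rw [← hrefl]
      refine Finset.sum_le_sum fun i hi => ?_
      have hi' : n + 1 - i = n - i + 1 := by rw [Finset.mem_range] at hi; omega
      obtain ⟨-, hb1, hb2, -⟩ := hbounds n (n - i)
      rw [← hdist i]
      have hXim := S.measurable_of_mem _ (hXs i)
      refine prob_mono (measurableSet_lt measurable_const hXim.abs) (hXim (hBm i))
        fun ω hω => ?_
      have hω' : 2 * C * triangleThreshold α (n, n - i) ^ p < |Xs i ω| := hω
      change 2 * (1 * cesaroNumber α (n + 1) ^ p) < |cesaroNumber (α - 1) (n + 1 - i) ^ p * Xs i ω|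
      rw [hi', abs_mul, abs_of_pos hb2]
      have h4 := mul_lt_mul_of_pos_left hω' hb2
      have h5 : cesaroNumber α (n + 1) ^ p ≤ C * triangleThreshold α (n, n - i) ^ p *
        cesaroNumber (α - 1) (n - i + 1) ^ p := hb1
      linarith
    have h6 : min (s n) 1 ≤ min (∑ i ∈ Finset.range (n + 1), S.prob (Xs i ⁻¹' B i)) 1 :=
      min_le_min h3 le_rfl
    have h7 : S.prob (⋃ i ∈ Finset.range (n + 1), Xs i ⁻¹' B i) ≤ _ := h1
    linarith
  refine lt_of_le_of_lt ?_ (ENNReal.mul_lt_top (ENNReal.ofReal_lt_top (r := 2)) hfin)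
  rw [← ENNReal.tsum_mul_left]
  refine ENNReal.tsum_le_tsum fun n => ?_
  rw [capacity_maxSum_eq hXs, mul_left_comm, ← ENNReal.ofReal_mul two_pos.le,
    ← ENNReal.ofReal_mul (by positivity)]
  refine ENNReal.ofReal_le_ofReal ?_
  push_cast
  exact mul_le_mul_of_nonneg_left (hmin n) (by positivity)

end SublinearExpectationSpace

/-! ### The three moment conditions -/

namespace SublinearExpectationSpace

variable {Ω : Type*} [MeasurableSpace Ω] {S : SublinearExpectationSpace Ω}

theorem choquet_rpow_lt_top_iff {X : Ω → ℝ} (hX : X ∈ S.H) {r p α c β : ℝ} (hr : 1 < r)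
    (hp : 0 < p) (hα0 : 0 < α) (hα1 : α ≤ 1) (hc : 0 < c) (hβ : 0 < β)
    (h1 : ∃ C, 0 < C ∧ ∀ t : ℝ, 1 ≤ t →
      t ^ ((r - 1) / α) * negPowerSum ((1 - α) * ((r - 1) / α)) ⌊t⌋₊ ≤ C * t ^ (p * β))
    (h2 : ∃ C, 0 < C ∧ ∀ t : ℝ, 4 ≤ t → t ^ (p * β) ≤
      C * (t ^ ((r - 1) / α) * negPowerSum ((1 - α) * ((r - 1) / α)) ⌊t / 4⌋₊)) :
    S.choquet (fun ω => |X ω| ^ β) < ⊤ ↔ S.triangleSum X r p α c < ⊤ := by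
  have e : ∀ t : ℝ, 0 ≤ t → (c * t ^ p) ^ β = c ^ β * t ^ (p * β) := fun t ht => by
    rw [Real.mul_rpow hc.le (by positivity), ← Real.rpow_mul ht]
  have hcβ : 0 < c ^ β := by positivity
  refine choquet_lt_top_iff_triangleSum hX hr hp hα0 hα1 hc (φ := fun x => x ^ β)
    (Real.strictMonoOn_rpow_Ici_of_exponent_pos hβ)
    ((Real.continuous_rpow_const hβ.le).comp continuous_abs) (Real.zero_rpow hβ.ne')
    (tendsto_rpow_atTop hβ) ?_ ?_
  · obtain ⟨C, hC, h⟩ := h1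
    refine ⟨C / c ^ β, by positivity, fun t ht => (h t ht).trans_eq ?_⟩
    rw [e t (by linarith)]
    field_simp
  · obtain ⟨C, hC, h⟩ := h2
    refine ⟨c ^ β * C, by positivity, fun t ht => ?_⟩
    rw [e t (by linarith), mul_assoc]
    exact mul_le_mul_of_nonneg_left (h t ht) hcβ.le

theorem choquet_rpow_mul_log_lt_top_iff {X : Ω → ℝ} (hX : X ∈ S.H) {r p α c : ℝ} (hr : 1 < r)
    (hp : 0 < p) (hα0 : 0 < α) (hα1 : α ≤ 1) (hc : 0 < c) (hα : α = 1 - 1 / r) :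
    S.choquet (fun ω => |X ω| ^ (r / p) * Real.log (1 + |X ω|)) < ⊤ ↔
      S.triangleSum X r p α c < ⊤ := by
  have hr0 : 0 < r := by linarith
  have hβ : 0 < r / p := by positivity
  -- At the critical α the exponent of k in the count is exactly 1, so the harmonic sum supplies the
  -- logarithm.
  have he1 : (r - 1) / α = r := by
    rw [div_eq_iff hα0.ne', hα]; field_simp
  have he2 : (1 - α) * ((r - 1) / α) = 1 := by
    rw [he1, hα]; field_simp; ring
  have e : ∀ t : ℝ, 0 ≤ t → (c * t ^ p) ^ (r / p) = c ^ (r / p) * t ^ r := fun t ht => by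
    rw [Real.mul_rpow hc.le (by positivity), ← Real.rpow_mul ht]
    congr 2; field_simp
  have hcβ : 0 < c ^ (r / p) := by positivity
  obtain ⟨⟨C₁, hC₁, h1⟩, ⟨C₂, hC₂, h2⟩⟩ := negPowerSum_one_bounds hc hp
  have hlog : ∀ x : ℝ, 0 ≤ x → 0 ≤ Real.log (1 + x) := fun x hx => Real.log_nonneg (by linarith)
  refine choquet_lt_top_iff_triangleSum hX hr hp hα0 hα1 hc
    (φ := fun x => x ^ (r / p) * Real.log (1 + x)) ?_ ?_ ?_ ?_ ?_ ?_
  · intro x hx y hy hxy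
    have hx : 0 ≤ x := hx
    have h3 : x ^ (r / p) < y ^ (r / p) := Real.rpow_lt_rpow hx hxy hβ
    have h4 : Real.log (1 + x) < Real.log (1 + y) :=
      Real.log_lt_log (by linarith) (by linarith)
    exact mul_lt_mul'' h3 h4 (by positivity) (hlog x hx)
  · refine ((Real.continuous_rpow_const hβ.le).comp continuous_abs).mul ?_
    exact (continuous_const.add continuous_abs).log fun x =>
      (add_pos_of_pos_of_nonneg one_pos (abs_nonneg x)).ne'
  · simp
  · refine (tendsto_rpow_atTop hβ).atTop_mul_atTop₀ ?_
    exact Real.tendsto_log_atTop.comp (Filter.tendsto_atTop_add_const_left _ _ Filter.tendsto_id)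
  · refine ⟨C₁ / c ^ (r / p), by positivity, fun t ht => ?_⟩
    rw [he2, he1, e t (by linarith)]
    calc t ^ r * negPowerSum 1 ⌊t⌋₊ ≤ t ^ r * (C₁ * Real.log (1 + c * t ^ p)) := by
          have := h1 t ht
          gcongr
      _ = _ := by field_simp
  · refine ⟨c ^ (r / p) * C₂, by positivity, fun t ht => ?_⟩
    rw [he2, he1, e t (by linarith)]
    calc c ^ (r / p) * t ^ r * Real.log (1 + c * t ^ p)
        ≤ c ^ (r / p) * t ^ r * (C₂ * negPowerSum 1 ⌊t / 4⌋₊) := by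
          have := h2 t ht
          gcongr
      _ = _ := by ring

theorem choquet_conditions_iff {X : Ω → ℝ} (hX : X ∈ S.H) {r p α c : ℝ} (hr : 1 < r)
    (hp : 0 < p) (hα0 : 0 < α) (hα1 : α ≤ 1) (hc : 0 < c) :
    ((α < 1 - 1 / r → S.choquet (fun ω => |X ω| ^ ((r - 1) / (p * α))) < ⊤) ∧
      (α = 1 - 1 / r → S.choquet (fun ω => |X ω| ^ (r / p) * Real.log (1 + |X ω|)) < ⊤) ∧
      (1 - 1 / r < α → S.choquet (fun ω => |X ω| ^ (r / p)) < ⊤)) ↔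
    S.triangleSum X r p α c < ⊤ := by
  have hr0 : 0 < r := by linarith
  have hr1 : 0 < r - 1 := by linarith
  -- This identity locates the exponent (1-α)(r-1)/α relative to 1: the sign of α - (1 - 1/r)
  -- selects the regime. In each, two of the three implications hold vacuously.
  have he : 1 - (1 - α) * ((r - 1) / α) = r * (α - (1 - 1 / r)) / α := by field_simp; ring
  rcases lt_trichotomy α (1 - 1 / r) with h | h | h
  · have hβ : p * ((r - 1) / (p * α)) = (r - 1) / α := by field_simp
    have hlt : 1 < (1 - α) * ((r - 1) / α) := by
      have : r * (α - (1 - 1 / r)) / α < 0 :=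
        div_neg_of_neg_of_pos (mul_neg_of_pos_of_neg hr0 (by linarith)) hα0
      linarith
    rw [← choquet_rpow_lt_top_iff hX hr hp hα0 hα1 hc (β := (r - 1) / (p * α)) (by positivity)]
    · exact ⟨fun H => H.1 h, fun H => ⟨fun _ => H, fun h' => absurd h' h.ne,
        fun h' => absurd h' h.le.not_gt⟩⟩
    · obtain ⟨C, hC, hb⟩ := exists_negPowerSum_le hlt
      refine ⟨C, hC, fun t ht => ?_⟩
      rw [hβ, mul_comm C]
      exact mul_le_mul_of_nonneg_left (hb _) (by positivity)
    · refine ⟨1, one_pos, fun t ht => ?_⟩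
      rw [hβ, one_mul]
      exact le_mul_of_one_le_right (by positivity)
        (one_le_negPowerSum _ (floor_div_four_bounds ht).1)
  · rw [← choquet_rpow_mul_log_lt_top_iff hX hr hp hα0 hα1 hc h]
    exact ⟨fun H => H.2.1 h, fun H => ⟨fun h' => absurd h h'.ne, fun _ => H,
      fun h' => absurd h h'.ne'⟩⟩
  · have hlt : (1 - α) * ((r - 1) / α) < 1 := by
      have : 0 < r * (α - (1 - 1 / r)) / α :=
        div_pos (mul_pos hr0 (by linarith)) hα0
      linarith
    have hnn : 0 ≤ (1 - α) * ((r - 1) / α) :=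
      mul_nonneg (by linarith) (by positivity)
    have hβ : p * (r / p) = (r - 1) / α + (1 - (1 - α) * ((r - 1) / α)) := by field_simp; ring
    obtain ⟨⟨C₁, hC₁, h1⟩, ⟨C₂, hC₂, h2⟩⟩ := negPowerSum_lt_one_bounds hnn hlt
    rw [← choquet_rpow_lt_top_iff hX hr hp hα0 hα1 hc (β := r / p) (by positivity)]
    · exact ⟨fun H => H.2.2 h, fun H => ⟨fun h' => absurd h' h.le.not_gt,
        fun h' => absurd h' h.ne', fun _ => H⟩⟩
    · refine ⟨C₁, hC₁, fun t ht => ?_⟩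
      rw [hβ, Real.rpow_add (by linarith), mul_left_comm]
      exact mul_le_mul_of_nonneg_left (h1 t ht) (by positivity)
    · refine ⟨C₂, hC₂, fun t ht => ?_⟩
      rw [hβ, Real.rpow_add (by linarith), mul_left_comm]
      exact mul_le_mul_of_nonneg_left (h2 t ht) (by positivity)

end SublinearExpectationSpace

/-! ### The equivalence -/

theorem corollary3p1 {Ω : Type*} [MeasurableSpace Ω] (S : SublinearExpectationSpace Ω)
    (hS : S.CountablySubadditive)
    (X : Ω → ℝ) (hX : X ∈ S.H)
    (Xs : ℕ → Ω → ℝ) (hXs : ∀ n, Xs n ∈ S.H)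
    (hindep : S.IndepSeq Xs) (hident : ∀ n, S.IdentDistr (Xs n) X)
    (hmean : ∀ i : ℕ, 1 ≤ i → S.E (Xs i) = 0 ∧ -S.E (fun ω => -Xs i ω) = 0)
    (r p α : ℝ) (hr : 1 < r) (hp : 1 / 2 < p) (hα0 : 0 < α) (hα1 : α ≤ 1) :
    ((α < 1 - 1 / r → S.choquet (fun ω => |X ω| ^ ((r - 1) / (p * α))) < ⊤) ∧
      (α = 1 - 1 / r → S.choquet (fun ω => |X ω| ^ (r / p) * Real.log (1 + |X ω|)) < ⊤) ∧
      (1 - 1 / r < α → S.choquet (fun ω => |X ω| ^ (r / p)) < ⊤)) ↔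
    ∀ ε : ℝ, 0 < ε →
      -- the summation index of the series is `n + 1 = 1, 2, …`
      ∑' n : ℕ, ENNReal.ofReal (((n + 1 : ℕ) : ℝ) ^ (r - 2)) *
        S.capacity {ω | ε * cesaroNumber α (n + 1) ^ p <
          (Finset.range (n + 1)).sup' Finset.nonempty_range_add_one (fun j =>
            |∑ i ∈ Finset.range (j + 1),
              cesaroNumber (α - 1) (n + 1 - i) ^ p * Xs i ω|)} < ⊤ := by
  have hp0 : 0 < p := by linarith
  constructor
  · intro H ε hε
    exact SublinearExpectationSpace.tsum_capacity_lt_top hS hX hXs hindep hident hmean hr hp hα0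
      hα1 (fun c hc =>
        (SublinearExpectationSpace.choquet_conditions_iff hX hr hp0 hα0 hα1 hc).1 H) hε
  · intro H
    -- ε = 1 alone yields finiteness for a single c, which is enough because the moment conditions
    -- do not involve c.
    obtain ⟨c, hc, hfin⟩ := SublinearExpectationSpace.exists_triangleSum_lt_top hX hXs hindep
      hident hr hp0 hα0 hα1 (H 1 one_pos)
    exact (SublinearExpectationSpace.choquet_conditions_iff hX hr hp0 hα0 hα1 hc).2 hfin
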